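/- Write $\beta_c=\sqrt{2\log 2}$. On a probability space, for every $N$, let $(X_{N,\sigma})_{\sigma\in\{-1,+1\}^N}$ be i.i.d. standard Gaussian random variables (no assumption is made on the joint law for different $N$), let $H_N(\sigma)=\sqrt N\,X_{N,\sigma}$ be the energies of the random energy model, and let $$\mu_{N,\beta}(\sigma)=\frac{e^{-\beta H_N(\sigma)}}{\sum_{\tau}e^{-\beta H_N(\tau)}}$$ be the Gibbs measure on $\{-1,+1\}^N$. Let $\tilde\sigma_1,\dots,\tilde\sigma_{2^N}$ be the configurations arranged in increasing order of energy. With $\Phi$ the standard normal distribution function, put $U_{j}=\Phi(X_{N,\tilde\sigma_j})$ for $1\le j\le 2^N$, $U_{2^N+1}=1$ and $$W_\ell=W_\ell^{(N)}=\ell\,\log\frac{U_{\ell+1}}{U_{\ell}},\qquad 1\le \ell\le 2^N .$$ For $1\le K\le 2^N$, let $\mu^{(2)}_{K,\beta}$ be the random probability measure on $\{-1,+1\}^N$ supported by $\{\tilde\sigma_1,\dots,\tilde\sigma_K\}$ that gives $\tilde\sigma_k$ a mass proportional to $\exp\bigl(-\frac{\beta}{\beta_c}\sum_{\ell=1}^{k-1}\frac{W_\ell}{\ell}\bigr)$.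 Let $d_{TV}(\mu,\nu)=\sup_{\|\Psi\|_\infty=1}|\mu(\Psi)-\nu(\Psi)|$. **Proposition 3.1.** For every $N$ the variables $W_1^{(N)},\dots,W_{2^N}^{(N)}$ are i.i.d. exponential with mean $1$. Moreover, there is an absolute constant $C>0$ such that, for all $\beta$ with $\beta/\beta_c>1$ and all sequences of integers $(k_N)$ with $k_N\to\infty$, $k_N/N\to\infty$ and $\varepsilon_N:=(\log k_N)(\log N)/N\to0$ as $N\to\infty$, with probability $1$, for all but finitely many $N$, $$d_{TV}\bigl(\mu_{N,\beta},\mu^{(2)}_{k_N,\beta}\bigr)\le C\,\frac{\beta}{\beta_c}\,\varepsilon_N\,\exp\Bigl\{C\,\frac{\beta}{\beta_c}\,\varepsilon_N\Bigr\}+\frac{4}{\beta/\beta_c-1}\,\frac{1}{(k_N-1)^{(\beta/\beta_c-1)/2}} .$$ -/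

import Mathlib

open MeasureTheory ProbabilityTheory Filter Topology

noncomputable section

namespace REM

/-- Spin configurations: the space `{-1, +1}^N`. -/
abbrev Config (N : ℕ) : Type := Fin N → ℤˣ

/-- The critical inverse temperature `β_c = √(2 log 2)`. -/
def betaC : ℝ := Real.sqrt (2 * Real.log 2)

/-- The energies `H_N(σ) = √N · x_σ` for a realization `x` of the disorder. -/
def hamiltonian {N : ℕ} (x : Config N → ℝ) (σ : Config N) : ℝ := Real.sqrt N * x σ

/-- The finite-volume partition function. -/
def partitionFunction {N : ℕ} (β : ℝ) (x : Config N → ℝ) : ℝ :=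
  ∑ σ : Config N, Real.exp (-β * hamiltonian x σ)

/-- The Gibbs measure, as the function giving the mass of each configuration. -/
def gibbs {N : ℕ} (β : ℝ) (x : Config N → ℝ) (σ : Config N) : ℝ :=
  Real.exp (-β * hamiltonian x σ) / partitionFunction β x

/-- The expectation `μ(Ψ)` of `Ψ` under the measure with masses `μ σ`. -/
def expect {N : ℕ} (μ Ψ : Config N → ℝ) : ℝ := ∑ σ : Config N, Ψ σ * μ σ

/-- Total variation distance, `sup |μ(Ψ) - ν(Ψ)|` over all `Ψ` with `‖Ψ‖_∞ = 1`. The norm on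
`Config N → ℝ` is the supremum norm. -/
def dTV {N : ℕ} (μ ν : Config N → ℝ) : ℝ :=
  ⨆ Ψ : {Ψ : Config N → ℝ // ‖Ψ‖ = 1}, |expect μ Ψ.1 - expect ν Ψ.1|

/-- A fixed enumeration of the `2 ^ N` configurations. -/
def configEnum (N : ℕ) : Fin (2 ^ N) ≃ Config N :=
  (Fintype.equivFinOfCardEq (by simp)).symm

/-- The configurations in increasing order of `x`, that is, of energy: `sortedConfig x i` is
the `(i+1)`-th lowest configuration (ties, if any, are broken by the enumeration). -/
def sortedConfig {N : ℕ} (x : Config N → ℝ) : Fin (2 ^ N) ≃ Config N :=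
  (Tuple.sort (x ∘ configEnum N)).trans (configEnum N)

/-- With `n = 2 ^ N`: the order statistics `U_{1,n} ≤ ⋯ ≤ U_{n,n}` of the variables `Φ(x_σ)`,
`Φ` being the standard normal distribution function, with `U_{0,n} = 0` and `U_{j,n} = 1`
for `j > n`. -/
def unifOrderStat {N : ℕ} (x : Config N → ℝ) (j : ℕ) : ℝ :=
  if j = 0 then 0
  else if h : j - 1 < 2 ^ N then cdf (gaussianReal 0 1) (x (sortedConfig x ⟨j - 1, h⟩))
  else 1

/-- The variables `W_ℓ = ℓ log (U_{ℓ+1,n} / U_{ℓ,n})`, `1 ≤ ℓ ≤ n = 2 ^ N`, attached to the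
realization `x`, i.e. `W_ℓ = - log ((U_{ℓ,n} / U_{ℓ+1,n}) ^ ℓ)`. -/
def expSpacing {N : ℕ} (x : Config N → ℝ) (ℓ : ℕ) : ℝ :=
  ℓ * Real.log (unifOrderStat x (ℓ + 1) / unifOrderStat x ℓ)

/-- Unnormalized masses of `μ^{(2)}`: the `(i+1)`-th lowest configuration, for `i < K`, has
weight `exp (-(β/β_c) ∑_{ℓ=1}^{i} W_ℓ / ℓ)`; the other configurations have weight `0`. -/
def approxWeight {N : ℕ} (K : ℕ) (β : ℝ) (x : Config N → ℝ) (W : ℕ → ℝ)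
    (σ : Config N) : ℝ :=
  if ((sortedConfig x).symm σ : ℕ) < K then
    Real.exp (-(β / betaC) *
      ∑ ℓ ∈ Finset.Icc 1 ((sortedConfig x).symm σ : ℕ), W ℓ / (ℓ : ℝ))
  else 0

/-- The random measure `μ^{(2)}_{K,β}`, supported by the `K` lowest configurations, as the
function giving the mass of each configuration. -/
def approxGibbs {N : ℕ} (K : ℕ) (β : ℝ) (x : Config N → ℝ) (W : ℕ → ℝ)
    (σ : Config N) : ℝ :=
  approxWeight K β x W σ / ∑ τ : Config N, approxWeight K β x W τ

/-- `ε_N = (log k_N)(log N) / N`, where `K = k_N`. -/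
def eps (K N : ℕ) : ℝ := Real.log K * Real.log N / N

end REM

end

namespace REM

/-! Law of the spacings. By the probability integral transform the variables -log Φ(X_σ) are i.i.d.
exponential. If Y_1 > Y_2 > ... > Y_n > 0 is their decreasing rearrangement (n = 2^N, Y_{n+1} = 0),
then W_ℓ = ℓ (Y_ℓ - Y_{ℓ+1}). This linear map has determinant n! and preserves the sum of the
coordinates, while the joint exponential density depends on the sum alone. Hence each of the n!
orderings contributes 1/n! of the product law (`map_spacings_eq_pi_expMeasure`).

Approximation. Put b = β/β_c, a = β_c √N, and let x_1 ≤ x_2 ≤ ... be the sorted disorder. The sums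
of W_ℓ/ℓ telescope to g_k = log (U_k/U_1), so, relative to the ground state, exp(-b a (x_k - x_1))
has to be compared with exp(-b g_k). The derivative of log Φ is the inverse Mills ratio, which is
decreasing and close to -x in the lower tail. The bounds U_1 > 2^{-N}/(N+1)^2 and U_K ≤ 4KN 2^{-N}
make it at most a (1 + δ) at x_1 and at least a/(1 + δ) at x_K, where δ = 4 (log K)/N
(`invMills_le_of_lower`, `le_invMills_of_top`). Therefore a (x_k - x_1) ≥ (1 - δ) g_k for all k, and
a (x_k - x_1) ≤ (1 + δ) g_k for k ≤ K.

Moreover exp(-g_k) ≤ 32 log(N+1)/k for k ≥ N, so the sums of exp(-(1+s) g_k) converge like those of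
k^{-(1+s)}, up to logarithms. In the weight comparison (`sum_abs_exp_sub_exp_le`) levels with g_k ≤
log N give the ε_N term, levels k ≤ K with larger g_k are absorbed in it, and levels k > K give the
power of K - 1. The bounds on the order statistics follow from union bounds and Borel–Cantelli
(`ae_eventually_regular`). -/

/-! ### Gaussian tails and the inverse Mills ratio. -/

lemma hasDerivAt_cdf_gaussianReal (x : ℝ) :
    HasDerivAt (cdf (gaussianReal 0 1)) (gaussianPDFReal 0 1 x) x := by
  have hint : Integrable (gaussianPDFReal 0 1) := integrable_gaussianPDFReal 0 1
  have hcont : Continuous (gaussianPDFReal 0 1) := by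
    unfold gaussianPDFReal; fun_prop
  have heq : (fun z => cdf (gaussianReal 0 1) z) = fun z =>
      cdf (gaussianReal 0 1) x + ∫ t in x..z, gaussianPDFReal 0 1 t := by
    have h (z : ℝ) : cdf (gaussianReal 0 1) z = ∫ t in Set.Iic z, gaussianPDFReal 0 1 t := by
      rw [cdf_eq_real, Measure.real, gaussianReal_apply_eq_integral 0 one_ne_zero,
        ENNReal.toReal_ofReal (integral_nonneg fun t => gaussianPDFReal_nonneg 0 1 t)]
    funext z
    rw [h, h, ← intervalIntegral.integral_Iic_sub_Iic hint.integrableOn hint.integrableOn]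
    ring
  change HasDerivAt (fun z => cdf (gaussianReal 0 1) z) _ x
  rw [heq]
  exact (intervalIntegral.integral_hasDerivAt_right (hint.intervalIntegrable)
    (hcont.stronglyMeasurableAtFilter _ _) hcont.continuousAt).const_add _

lemma continuous_cdf_gaussianReal : Continuous (cdf (gaussianReal 0 1)) :=
  continuous_iff_continuousAt.2 fun x => (hasDerivAt_cdf_gaussianReal x).continuousAt

lemma strictMono_cdf_gaussianReal : StrictMono (cdf (gaussianReal 0 1)) :=
  strictMono_of_deriv_pos fun x => by
    rw [(hasDerivAt_cdf_gaussianReal x).deriv]; exact gaussianPDFReal_pos 0 1 x one_ne_zero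

lemma cdf_gaussianReal_pos (x : ℝ) : 0 < cdf (gaussianReal 0 1) x :=
  (cdf_nonneg _ (x - 1)).trans_lt (strictMono_cdf_gaussianReal (by linarith))

lemma cdf_gaussianReal_lt_one (x : ℝ) : cdf (gaussianReal 0 1) x < 1 :=
  (strictMono_cdf_gaussianReal (by linarith : x < x + 1)).trans_le (cdf_le_one _ _)

lemma hasDerivAt_gaussianPDFReal (x : ℝ) :
    HasDerivAt (gaussianPDFReal 0 1) (-x * gaussianPDFReal 0 1 x) x := by
  have h : HasDerivAt (fun t : ℝ => -(t - 0) ^ 2 / (2 * ((1 : NNReal) : ℝ))) (-x) x := by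
    have := ((((hasDerivAt_id x).sub_const 0).pow 2).neg).div_const (2 * ((1 : NNReal) : ℝ))
    refine this.congr_deriv ?_
    simp
    ring
  refine (h.exp.const_mul _).congr_deriv ?_
  simp only [gaussianPDFReal]
  ring

lemma gaussianPDFReal_zero_one (x : ℝ) :
    gaussianPDFReal 0 1 x = (Real.sqrt (2 * Real.pi))⁻¹ * Real.exp (-x ^ 2 / 2) := by
  simp [gaussianPDFReal]

lemma tendsto_gaussianPDFReal_atBot : Tendsto (gaussianPDFReal 0 1) atBot (𝓝 0) := by
  have h : Tendsto (fun x : ℝ => (Real.sqrt (2 * Real.pi))⁻¹ * Real.exp (-x ^ 2 / 2)) atBot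
      (𝓝 ((Real.sqrt (2 * Real.pi))⁻¹ * 0)) := by
    refine Tendsto.const_mul _ (Real.tendsto_exp_atBot.comp ?_)
    have h2 : Tendsto (fun x : ℝ => x ^ 2 / 2) atBot atTop :=
      Tendsto.atTop_div_const two_pos (by
        have := (tendsto_pow_atTop (α := ℝ) two_ne_zero).comp tendsto_neg_atBot_atTop
        refine this.congr fun x => by simp)
    refine (tendsto_neg_atTop_atBot.comp h2).congr fun x => ?_
    simp only [Function.comp]; ring
  rw [mul_zero] at h
  exact h.congr fun x => (gaussianPDFReal_zero_one x).symm

/-- A differentiable function vanishing at `-∞` with nonnegative derivative is nonnegative. -/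
lemma nonneg_of_hasDerivAt_nonneg_of_tendsto_atBot {F F' : ℝ → ℝ} {x : ℝ}
    (hF : ∀ t ≤ x, HasDerivAt F (F' t) t) (hF' : ∀ t ≤ x, 0 ≤ F' t)
    (hlim : Tendsto F atBot (𝓝 0)) : 0 ≤ F x := by
  have hmono : MonotoneOn F (Set.Iic x) := by
    refine monotoneOn_of_deriv_nonneg (convex_Iic x)
      (fun t ht => (hF t ht).continuousAt.continuousWithinAt)
      (fun t ht => (hF t (interior_subset (s := Set.Iic x) ht)).differentiableAt.differentiableWithinAt)
      fun t ht => ?_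
    rw [(hF t (interior_subset (s := Set.Iic x) ht)).deriv]
    exact hF' t (interior_subset (s := Set.Iic x) ht)
  refine le_of_tendsto hlim ?_
  filter_upwards [eventually_le_atBot x] with t ht
  exact hmono ht (Set.mem_Iic.2 le_rfl) ht

/-- Upper bound of the Gaussian tail. -/
lemma neg_mul_cdf_gaussianReal_le (x : ℝ) :
    -x * cdf (gaussianReal 0 1) x ≤ gaussianPDFReal 0 1 x := by
  have h := nonneg_of_hasDerivAt_nonneg_of_tendsto_atBot (x := x)
    -- The factor -x is frozen at the endpoint, so that the derivative is (x - t) φ(t), nonnegative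
    -- for t ≤ x.
    (F := fun t => gaussianPDFReal 0 1 t - (-x) * cdf (gaussianReal 0 1) t)
    (F' := fun t => -t * gaussianPDFReal 0 1 t - (-x) * gaussianPDFReal 0 1 t)
    (fun t _ => (hasDerivAt_gaussianPDFReal t).sub ((hasDerivAt_cdf_gaussianReal t).const_mul _))
    (fun t ht => by
      rw [← sub_mul]
      exact mul_nonneg (by linarith) (gaussianPDFReal_nonneg _ _ _))
    (by
      have := tendsto_gaussianPDFReal_atBot.sub
        ((tendsto_cdf_atBot (gaussianReal 0 1)).const_mul (-x))
      rwa [mul_zero, sub_zero] at this)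
  linarith

/-- Lower bound of the Gaussian tail. -/
lemma neg_mul_gaussianPDFReal_le {x : ℝ} (hx : x < 0) :
    -x * gaussianPDFReal 0 1 x ≤ (1 + x ^ 2) * cdf (gaussianReal 0 1) x := by
  have hlim : Tendsto (fun t : ℝ => gaussianPDFReal 0 1 t * (-t)⁻¹) atBot (𝓝 (0 * 0)) :=
    tendsto_gaussianPDFReal_atBot.mul (tendsto_inv_atTop_zero.comp tendsto_neg_atBot_atTop)
  have h := nonneg_of_hasDerivAt_nonneg_of_tendsto_atBot (x := x)
    -- The derivative of φ(t)/(-t) is (1 + t⁻²) φ(t), and t⁻² ≤ x⁻² for t ≤ x < 0.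
    (F := fun t => (1 + (x ^ 2)⁻¹) * cdf (gaussianReal 0 1) t - gaussianPDFReal 0 1 t * (-t)⁻¹)
    (F' := fun t => (1 + (x ^ 2)⁻¹) * gaussianPDFReal 0 1 t
      - (1 + (t ^ 2)⁻¹) * gaussianPDFReal 0 1 t)
    (fun t ht => by
      have ht0 : t ≠ 0 := by linarith
      refine ((hasDerivAt_cdf_gaussianReal t).const_mul _).sub ?_
      refine ((hasDerivAt_gaussianPDFReal t).mul
        ((hasDerivAt_neg' t).inv (neg_ne_zero.2 ht0))).congr_deriv ?_
      simp only [Pi.inv_apply]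
      field_simp)
    (fun t ht => by
      rw [← sub_mul]
      refine mul_nonneg ?_ (gaussianPDFReal_nonneg _ _ _)
      have : (t ^ 2)⁻¹ ≤ (x ^ 2)⁻¹ := by
        apply inv_anti₀ (by nlinarith)
        nlinarith
      linarith)
    (by
      have := ((tendsto_cdf_atBot (gaussianReal 0 1)).const_mul (1 + (x ^ 2)⁻¹)).sub hlim
      rwa [mul_zero, mul_zero, sub_zero] at this)
  have hx0 : x ≠ 0 := hx.ne
  have h2 : 0 ≤ x ^ 2 * ((1 + (x ^ 2)⁻¹) * cdf (gaussianReal 0 1) x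
      - gaussianPDFReal 0 1 x * (-x)⁻¹) := mul_nonneg (sq_nonneg x) h
  have h3 : x ^ 2 * ((1 + (x ^ 2)⁻¹) * cdf (gaussianReal 0 1) x
      - gaussianPDFReal 0 1 x * (-x)⁻¹) = (1 + x ^ 2) * cdf (gaussianReal 0 1) x
      - -x * gaussianPDFReal 0 1 x := by
    field_simp
    ring
  linarith

/-- The logarithmic derivative of the standard normal distribution function. -/
noncomputable def invMills (x : ℝ) : ℝ := gaussianPDFReal 0 1 x / cdf (gaussianReal 0 1) x

lemma neg_le_invMills (x : ℝ) : -x ≤ invMills x := by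
  rw [invMills, le_div_iff₀ (cdf_gaussianReal_pos x)]
  exact neg_mul_cdf_gaussianReal_le x

lemma invMills_pos (x : ℝ) : 0 < invMills x :=
  div_pos (gaussianPDFReal_pos 0 1 x one_ne_zero) (cdf_gaussianReal_pos x)

lemma invMills_le {x : ℝ} (hx : x < 0) : invMills x ≤ (1 + x ^ 2) / (-x) := by
  rw [invMills, div_le_div_iff₀ (cdf_gaussianReal_pos x) (by linarith)]
  linarith [neg_mul_gaussianPDFReal_le hx]

lemma hasDerivAt_log_cdf_gaussianReal (x : ℝ) :
    HasDerivAt (fun t => Real.log (cdf (gaussianReal 0 1) t)) (invMills x) x :=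
  (hasDerivAt_cdf_gaussianReal x).log (cdf_gaussianReal_pos x).ne'

/-- Log-concavity of Φ: the derivative of φ/Φ is -φ (xΦ + φ)/Φ², whose sign is given by the upper
tail bound. Thanks to it, estimates at the first and the K-th levels control all levels in between.
-/
lemma antitone_invMills : Antitone invMills := by
  have hd (x : ℝ) := (hasDerivAt_gaussianPDFReal x).div (hasDerivAt_cdf_gaussianReal x)
    (cdf_gaussianReal_pos x).ne'
  refine antitone_of_deriv_nonpos (fun x => (hd x).differentiableAt) fun x => ?_
  refine (hd x).deriv.trans_le ?_
  refine div_nonpos_of_nonpos_of_nonneg ?_ (sq_nonneg _)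
  have h1 : 0 ≤ gaussianPDFReal 0 1 x := gaussianPDFReal_nonneg 0 1 x
  have h2 : 0 ≤ x * cdf (gaussianReal 0 1) x + gaussianPDFReal 0 1 x := by
    linarith [neg_mul_cdf_gaussianReal_le x]
  nlinarith [mul_nonneg h1 h2]

lemma log_cdf_gaussianReal_sub_mem {x z : ℝ} (hxz : x ≤ z) :
    invMills z * (z - x) ≤
        Real.log (cdf (gaussianReal 0 1) z) - Real.log (cdf (gaussianReal 0 1) x) ∧
      Real.log (cdf (gaussianReal 0 1) z) - Real.log (cdf (gaussianReal 0 1) x) ≤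
        invMills x * (z - x) := by
  rcases hxz.eq_or_lt with rfl | hlt
  · simp
  obtain ⟨ξ, hξ, hs⟩ := exists_hasDerivAt_eq_slope
    (fun t => Real.log (cdf (gaussianReal 0 1) t)) invMills hlt
    (fun t _ => (hasDerivAt_log_cdf_gaussianReal t).continuousAt.continuousWithinAt)
    fun t _ => hasDerivAt_log_cdf_gaussianReal t
  rw [eq_div_iff (by linarith)] at hs
  have hz := antitone_invMills hξ.2.le
  have hx := antitone_invMills hξ.1.le
  rw [← hs]
  constructor <;> gcongr

/-! ### Probability integral transform. -/

lemma exists_cdf_gaussianReal_eq {u : ℝ} (h0 : 0 < u) (h1 : u < 1) :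
    ∃ q, cdf (gaussianReal 0 1) q = u := by
  obtain ⟨a, ha⟩ := ((tendsto_cdf_atBot (gaussianReal 0 1)).eventually_lt_const h0).exists
  obtain ⟨b, hb⟩ := ((tendsto_cdf_atTop (gaussianReal 0 1)).eventually_const_lt h1).exists
  exact mem_range_of_exists_le_of_exists_ge continuous_cdf_gaussianReal ⟨a, ha.le⟩ ⟨b, hb.le⟩

lemma gaussianReal_cdf_le {u : ℝ} (h0 : 0 < u) (h1 : u < 1) :
    gaussianReal 0 1 {x | cdf (gaussianReal 0 1) x ≤ u} = ENNReal.ofReal u := by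
  obtain ⟨q, rfl⟩ := exists_cdf_gaussianReal_eq h0 h1
  rw [ofReal_cdf]
  congr 1
  ext x
  exact strictMono_cdf_gaussianReal.le_iff_le

lemma gaussianReal_cdf_lt {u : ℝ} (h0 : 0 < u) (h1 : u < 1) :
    gaussianReal 0 1 {x | cdf (gaussianReal 0 1) x < u} = ENNReal.ofReal u := by
  obtain ⟨q, rfl⟩ := exists_cdf_gaussianReal_eq h0 h1
  have : NullSingletonClass (gaussianReal 0 1) := nullSingletonClass_gaussianReal one_ne_zero
  rw [ofReal_cdf, ← measure_congr Iio_ae_eq_Iic]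
  congr 1
  ext x
  exact strictMono_cdf_gaussianReal.lt_iff_lt

lemma measurable_cdf_gaussianReal : Measurable (cdf (gaussianReal 0 1)) :=
  continuous_cdf_gaussianReal.measurable

lemma neg_log_cdf_gaussianReal_pos (x : ℝ) : 0 < -Real.log (cdf (gaussianReal 0 1) x) :=
  neg_pos.2 (Real.log_neg (cdf_gaussianReal_pos x) (cdf_gaussianReal_lt_one x))

lemma measurable_neg_log_cdf_gaussianReal :
    Measurable fun x => -Real.log (cdf (gaussianReal 0 1) x) :=
  (measurable_cdf_gaussianReal.log).neg

/-- The probability integral transform, in its exponential form. -/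
lemma map_neg_log_cdf_gaussianReal :
    (gaussianReal 0 1).map (fun x => -Real.log (cdf (gaussianReal 0 1) x)) = expMeasure 1 := by
  have := isProbabilityMeasure_expMeasure one_pos
  have := Measure.isProbabilityMeasure_map (μ := gaussianReal 0 1)
    measurable_neg_log_cdf_gaussianReal.aemeasurable
  refine Measure.eq_of_cdf _ _ ?_
  ext t
  rw [cdf_expMeasure_eq one_pos, cdf_eq_real, measureReal_def,
    Measure.map_apply measurable_neg_log_cdf_gaussianReal measurableSet_Iic]
  rcases le_or_gt t 0 with ht | ht
  · have h0 : (fun x => -Real.log (cdf (gaussianReal 0 1) x)) ⁻¹' Set.Iic t = ∅ := by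
      ext x
      have := neg_log_cdf_gaussianReal_pos x
      simp only [Set.mem_preimage, Set.mem_Iic, Set.mem_empty_iff_false, iff_false]
      linarith
    rw [h0]
    rcases ht.eq_or_lt with rfl | h
    · simp
    · simp [h]
  · have h0 : (fun x => -Real.log (cdf (gaussianReal 0 1) x)) ⁻¹' Set.Iic t =
        {x | cdf (gaussianReal 0 1) x < Real.exp (-t)}ᶜ := by
      ext x
      simp only [Set.mem_preimage, Set.mem_Iic, Set.mem_compl_iff, Set.mem_ofPred_eq, not_lt]
      rw [neg_le, Real.le_log_iff_exp_le (cdf_gaussianReal_pos x)]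
    have he : Real.exp (-t) < 1 := by rw [← Real.exp_zero]; exact Real.exp_lt_exp.2 (by linarith)
    rw [h0, prob_compl_eq_one_sub (measurableSet_lt measurable_cdf_gaussianReal measurable_const),
      gaussianReal_cdf_lt (Real.exp_pos _) he, ENNReal.toReal_sub_of_le (by
        rw [ENNReal.ofReal_le_one]; exact he.le) ENNReal.one_ne_top]
    simp [ht.le, (Real.exp_pos (-t)).le]

/-! ### Product measures with densities. -/

section PiWithDensity

open scoped ENNReal

lemma lintegral_fin_prod_eq_prod {n : ℕ} (μ : Fin n → Measure ℝ)
    [∀ i, SigmaFinite (μ i)] (f : Fin n → ℝ → ℝ≥0∞) (hf : ∀ i, Measurable (f i)) :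
    ∫⁻ x, ∏ i, f i (x i) ∂(Measure.pi μ) = ∏ i, ∫⁻ x, f i x ∂(μ i) := by
  induction n with
  | zero => simp
  | succ n ih =>
    calc ∫⁻ x, ∏ i, f i (x i) ∂(Measure.pi μ)
        = ∫⁻ x : ℝ × (Fin n → ℝ), f 0 x.1 * ∏ i : Fin n, f i.succ (x.2 i)
            ∂((μ 0).prod (Measure.pi fun i => μ i.succ)) := by
          rw [← ((measurePreserving_piFinSuccAbove μ 0).symm).lintegral_comp_emb
            (MeasurableEquiv.measurableEmbedding _)]
          simp_rw [MeasurableEquiv.piFinSuccAbove_symm_apply, Fin.insertNthEquiv,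
            Fin.prod_univ_succ, Fin.insertNth_zero, Equiv.coe_fn_mk, Fin.cons_succ,
            Fin.zero_succAbove, Fin.cons_zero, cast_eq]
      _ = _ := by
          have := lintegral_prod_mul (μ := μ 0) (ν := Measure.pi fun i : Fin n => μ i.succ)
            (f := f 0) (g := fun y : Fin n → ℝ => ∏ i : Fin n, f i.succ (y i))
            (hf 0).aemeasurable (Finset.measurable_prod _ fun i _ =>
              (hf i.succ).comp (measurable_pi_apply i)).aemeasurable
          rw [this, ih _ _ fun i => hf _, Fin.prod_univ_succ]

lemma pi_withDensity_fin {n : ℕ} (f : ℝ → ℝ≥0∞) (hf : Measurable f)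
    [SigmaFinite (volume.withDensity f)] :
    Measure.pi (fun _ : Fin n => volume.withDensity f) =
      (volume : Measure (Fin n → ℝ)).withDensity fun y => ∏ i, f (y i) := by
  refine Measure.pi_eq fun s hs => ?_
  rw [withDensity_apply _ (MeasurableSet.univ_pi hs),
    ← lintegral_indicator (MeasurableSet.univ_pi hs)]
  have : (Set.univ.pi s).indicator (fun y : Fin n → ℝ => ∏ i, f (y i)) =
      fun y => ∏ i, (s i).indicator f (y i) := by
    ext y
    by_cases hy : y ∈ Set.univ.pi s
    · rw [Set.indicator_of_mem hy]
      exact Finset.prod_congr rfl fun i _ => (Set.indicator_of_mem (hy i trivial) _).symm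
    · rw [Set.indicator_of_notMem hy]
      simp only [Set.mem_pi, Set.mem_univ, true_implies, not_forall] at hy
      obtain ⟨i, hi⟩ := hy
      exact (Finset.prod_eq_zero (Finset.mem_univ i) (Set.indicator_of_notMem hi _)).symm
  rw [this, volume_pi, lintegral_fin_prod_eq_prod _ (fun i => (s i).indicator f)
    fun i => hf.indicator (hs i)]
  refine Finset.prod_congr rfl fun i _ => ?_
  rw [lintegral_indicator (hs i), withDensity_apply _ (hs i)]

end PiWithDensity

/-! ### The linear map of normalized spacings. -/

section Spacings

variable {n : ℕ}

/-- Extension of a vector by zero. -/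
def extendZero (y : Fin n → ℝ) (i : ℕ) : ℝ := if h : i < n then y ⟨i, h⟩ else 0

/-- The matrix of the map `y ↦ ((i + 1) (y i - y (i + 1)))_i`, where `y n = 0`. -/
def spacingMatrix (n : ℕ) : Matrix (Fin n) (Fin n) ℝ :=
  fun i j => if j = i then (i : ℝ) + 1 else if (j : ℕ) = i + 1 then -((i : ℝ) + 1) else 0

lemma spacingMatrix_mulVec (y : Fin n → ℝ) (i : Fin n) :
    Matrix.toLin' (spacingMatrix n) y i =
      ((i : ℝ) + 1) * (extendZero y i - extendZero y (i + 1)) := by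
  rw [Matrix.toLin'_apply, Matrix.mulVec, dotProduct]
  have h1 : ∀ j, spacingMatrix n i j * y j =
      (if j = i then ((i : ℝ) + 1) * y j else 0) +
        (if (j : ℕ) = i + 1 then -((i : ℝ) + 1) * y j else 0) := by
    intro j
    unfold spacingMatrix
    by_cases h : j = i
    · subst h; simp
    · simp [h]
  rw [Finset.sum_congr rfl fun j _ => h1 j, Finset.sum_add_distrib,
    Finset.sum_ite_eq' Finset.univ i]
  have h2 : ∑ j : Fin n, (if (j : ℕ) = i + 1 then -((i : ℝ) + 1) * y j else 0) =
      -((i : ℝ) + 1) * extendZero y (i + 1) := by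
    unfold extendZero
    split_ifs with h
    · rw [Finset.sum_eq_single (⟨i + 1, h⟩ : Fin n)]
      · simp
      · intro j _ hj
        rw [if_neg fun h' => hj (Fin.ext h')]
      · simp
    · rw [mul_zero]
      refine Finset.sum_eq_zero fun j _ => ?_
      rw [if_neg fun h' => h (by omega)]
  rw [h2]
  simp only [Finset.mem_univ, if_true, extendZero, i.2, dif_pos]
  ring

lemma det_spacingMatrix : (spacingMatrix n).det = n.factorial := by
  rw [Matrix.det_of_isUpperTriangular]
  · simp only [spacingMatrix, if_true]
    rw [Fin.prod_univ_eq_prod_range (fun i : ℕ => (i : ℝ) + 1), ← Finset.prod_range_add_one_eq_factorial]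
    push_cast
    rfl
  · intro i j hij
    have hij' : (j : ℕ) < i := hij
    unfold spacingMatrix
    rw [if_neg (by rintro rfl; simp at hij'), if_neg (by omega)]

/-- Summation by parts; the boundary term vanishes because the vector is extended by zero. -/
lemma sum_spacingMatrix (y : Fin n → ℝ) :
    ∑ i, Matrix.toLin' (spacingMatrix n) y i = ∑ i, y i := by
  have h : ∀ m, ∑ i ∈ Finset.range m, ((i : ℝ) + 1) * (extendZero y i - extendZero y (i + 1)) =
      ∑ i ∈ Finset.range m, extendZero y i - m * extendZero y m := by
    intro m
    induction m with
    | zero => simp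
    | succ m ih => rw [Finset.sum_range_succ, Finset.sum_range_succ, ih]; push_cast; ring
  simp_rw [spacingMatrix_mulVec]
  rw [Fin.sum_univ_eq_sum_range
    (fun i : ℕ => ((i : ℝ) + 1) * (extendZero y i - extendZero y (i + 1))), h n,
    ← Fin.sum_univ_eq_sum_range]
  simp [extendZero]

lemma extendZero_succ_lt {y : Fin n → ℝ} (hy : ∀ i, 0 < Matrix.toLin' (spacingMatrix n) y i)
    {i : ℕ} (hi : i < n) : extendZero y (i + 1) < extendZero y i := by
  have := hy ⟨i, hi⟩
  rw [spacingMatrix_mulVec] at this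
  have h2 := pos_of_mul_pos_right this (by positivity)
  simpa using h2

lemma extendZero_lt_of_lt {y : Fin n → ℝ} (hy : ∀ i, 0 < Matrix.toLin' (spacingMatrix n) y i)
    {i j : ℕ} (hij : i < j) (hj : j ≤ n) : extendZero y j < extendZero y i := by
  induction j, hij using Nat.le_induction with
  | base => exact extendZero_succ_lt hy hj
  | succ j hij ih => exact (extendZero_succ_lt hy hj).trans (ih (by omega))

lemma strictAnti_of_spacing_pos {y : Fin n → ℝ}
    (hy : ∀ i, 0 < Matrix.toLin' (spacingMatrix n) y i) : StrictAnti y := by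
  intro i j hij
  have := extendZero_lt_of_lt hy (Fin.lt_def.1 hij) j.2.le
  simpa [extendZero] using this

lemma pos_of_spacing_pos {y : Fin n → ℝ}
    (hy : ∀ i, 0 < Matrix.toLin' (spacingMatrix n) y i) (i : Fin n) : 0 < y i := by
  have := extendZero_lt_of_lt hy i.2 le_rfl
  simpa [extendZero] using this

end Spacings

/-! ### Rényi's representation of exponential order statistics. -/

section Renyi

open scoped ENNReal

variable {n : ℕ}

lemma expMeasure_Ioi_zero : expMeasure 1 (Set.Ioi 0) = 1 := by
  have := isProbabilityMeasure_expMeasure one_pos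
  rw [← Set.compl_Iic, prob_compl_eq_one_sub measurableSet_Iic, ← ofReal_cdf,
    cdf_expMeasure_eq one_pos]
  simp

lemma pi_expMeasure_eq : Measure.pi (fun _ : Fin n => expMeasure 1) =
    (volume : Measure (Fin n → ℝ)).withDensity fun y => ∏ i, exponentialPDF 1 (y i) := by
  have := isProbabilityMeasure_expMeasure one_pos
  have h : expMeasure 1 = volume.withDensity (exponentialPDF 1) := rfl
  have : SigmaFinite (volume.withDensity (exponentialPDF 1)) := h ▸ inferInstance
  rw [h]
  exact pi_withDensity_fin _ (measurable_exponentialPDFReal 1).ennreal_ofReal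

lemma prod_exponentialPDF {y : Fin n → ℝ} (hy : ∀ i, 0 < y i) :
    ∏ i, exponentialPDF 1 (y i) = ENNReal.ofReal (Real.exp (-∑ i, y i)) := by
  rw [← Finset.sum_neg_distrib, Real.exp_sum,
    ENNReal.ofReal_prod_of_nonneg fun i _ => (Real.exp_pos _).le]
  refine Finset.prod_congr rfl fun i _ => ?_
  rw [exponentialPDF_of_nonneg (hy i).le]
  simp

/-- Change of variables. Positive spacings force positive coordinates, and on positive vectors the
density is exp of minus the sum, which the map preserves; only the Jacobian 1/n! remains. -/
lemma pi_expMeasure_preimage_spacingMatrix {B : Set (Fin n → ℝ)} (hB : MeasurableSet B) :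
    Measure.pi (fun _ : Fin n => expMeasure 1)
      (Matrix.toLin' (spacingMatrix n) ⁻¹' (B ∩ Set.univ.pi fun _ => Set.Ioi 0)) =
    (n.factorial : ℝ≥0∞)⁻¹ * Measure.pi (fun _ : Fin n => expMeasure 1) B := by
  have := isProbabilityMeasure_expMeasure one_pos
  set ρ := Measure.pi (fun _ : Fin n => expMeasure 1) with hρ
  set Q : Set (Fin n → ℝ) := Set.univ.pi fun _ => Set.Ioi 0 with hQ
  have hQm : MeasurableSet Q := MeasurableSet.univ_pi fun _ => measurableSet_Ioi
  have hmem (y : Fin n → ℝ) : y ∈ Q ↔ ∀ i, 0 < y i := by simp [hQ]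
  have hMm : Measurable (Matrix.toLin' (spacingMatrix n)) :=
    (LinearMap.continuous_on_pi _).measurable
  have hEm : Measurable fun y : Fin n → ℝ => ∏ i, exponentialPDF 1 (y i) :=
    Finset.measurable_prod _ fun i _ =>
      ((measurable_exponentialPDFReal 1).ennreal_ofReal).comp (measurable_pi_apply i)
  have hρQ : ρ Q = 1 := by
    rw [hρ, hQ, Measure.pi_pi]
    simp [expMeasure_Ioi_zero]
  have hBQ : ρ (B ∩ Q) = ρ B :=
    measure_inter_conull ((prob_compl_eq_zero_iff hQm).2 hρQ)
  have hdet : (spacingMatrix n).det ≠ 0 := by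
    rw [det_spacingMatrix]
    exact_mod_cast n.factorial_ne_zero
  rw [← hBQ, hρ, pi_expMeasure_eq, withDensity_apply _ (hMm (hB.inter hQm)),
    withDensity_apply _ (hB.inter hQm), ← lintegral_indicator (hMm (hB.inter hQm))]
  have h1 : ((Matrix.toLin' (spacingMatrix n)) ⁻¹' (B ∩ Q)).indicator
      (fun y : Fin n → ℝ => ∏ i, exponentialPDF 1 (y i)) = fun y =>
      (B ∩ Q).indicator (fun y => ∏ i, exponentialPDF 1 (y i))
        (Matrix.toLin' (spacingMatrix n) y) := by
    ext y
    by_cases hy : Matrix.toLin' (spacingMatrix n) y ∈ B ∩ Q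
    · rw [Set.indicator_of_mem (by exact hy), Set.indicator_of_mem hy]
      have hy' := (hmem _).1 hy.2
      rw [prod_exponentialPDF hy', prod_exponentialPDF (pos_of_spacing_pos hy'),
        sum_spacingMatrix]
    · rw [Set.indicator_of_notMem (by exact hy), Set.indicator_of_notMem hy]
  rw [h1, ← lintegral_map (f := (B ∩ Q).indicator (fun y => ∏ i, exponentialPDF 1 (y i)))
    (hEm.indicator (hB.inter hQm)) hMm, Real.map_matrix_volume_pi_eq_smul_volume_pi hdet,
    lintegral_smul_measure, lintegral_indicator (hB.inter hQm), det_spacingMatrix, smul_eq_mul,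
    abs_of_pos (by positivity), ENNReal.ofReal_inv_of_pos (by positivity), ENNReal.ofReal_natCast]

/-- **Rényi's representation**: if `W` consists of the normalized spacings of the decreasing
rearrangement of i.i.d. exponential variables whenever these are distinct, then its coordinates
are i.i.d. exponential. -/
lemma map_spacings_eq_pi_expMeasure {Ω : Type*} [MeasurableSpace Ω] {P : Measure Ω}
    [IsProbabilityMeasure P] {Y W : Ω → Fin n → ℝ} (hY : Measurable Y) (hW : Measurable W)
    (hlaw : P.map Y = Measure.pi fun _ => expMeasure 1)
    (hYW : ∀ ω (π : Equiv.Perm (Fin n)),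
      StrictAnti (Y ω ∘ π) → W ω = Matrix.toLin' (spacingMatrix n) (Y ω ∘ π)) :
    P.map W = Measure.pi fun _ => expMeasure 1 := by
  have := isProbabilityMeasure_expMeasure one_pos
  have := Measure.isProbabilityMeasure_map (μ := P) hW.aemeasurable
  symm
  -- Between probability measures domination is equality. Only outcomes without ties have to be
  -- counted, and ties need no separate treatment.
  refine Measure.eq_of_le_of_isProbabilityMeasure (Measure.le_iff.2 fun A hA => ?_)
  set Q : Set (Fin n → ℝ) := Set.univ.pi fun _ => Set.Ioi 0 with hQ
  have hQm : MeasurableSet Q := MeasurableSet.univ_pi fun _ => measurableSet_Ioi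
  have hmem (y : Fin n → ℝ) : y ∈ Q ↔ ∀ i, 0 < y i := by simp [hQ]
  have hMm : Measurable (Matrix.toLin' (spacingMatrix n)) :=
    (LinearMap.continuous_on_pi _).measurable
  set S : Set (Fin n → ℝ) := Matrix.toLin' (spacingMatrix n) ⁻¹' (A ∩ Q) with hS
  have hSm : MeasurableSet S := hMm (hA.inter hQm)
  have hcomp (π : Equiv.Perm (Fin n)) : Measurable fun y : Fin n → ℝ => y ∘ π :=
    measurable_pi_lambda _ fun i => measurable_pi_apply _
  have hanti {y : Fin n → ℝ} (hy : y ∈ S) : StrictAnti y :=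
    strictAnti_of_spacing_pos ((hmem _).1 hy.2)
  have hperm (π : Equiv.Perm (Fin n)) : P {ω | Y ω ∘ π ∈ S} =
      (n.factorial : ℝ≥0∞)⁻¹ * Measure.pi (fun _ : Fin n => expMeasure 1) A := by
    -- Exchangeability: permuting the coordinates preserves the product measure.
    have hp := (measurePreserving_arrowCongr' (fun _ : Fin n => expMeasure 1)
      (fun _ : Fin n => expMeasure 1) π.symm (MeasurableEquiv.refl ℝ)
      fun _ => MeasurePreserving.id _)
    rw [← pi_expMeasure_preimage_spacingMatrix hA, ← hp.measure_preimage hSm.nullMeasurableSet,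
      ← hlaw, Measure.map_apply hY (hp.measurable hSm)]
    rfl
  -- A vector with distinct entries has only one decreasing arrangement.
  have hdisj : Pairwise (Function.onFun Disjoint
      fun π : Equiv.Perm (Fin n) => {ω | Y ω ∘ π ∈ S}) := by
    intro π π' hne
    refine Set.disjoint_left.2 fun ω h h' => hne ?_
    have h1 := hanti h
    have h2 := hanti h'
    have h3 := Tuple.unique_antitone h1.antitone h2.antitone
    ext i
    have h4 : Function.Injective (Y ω) := by
      have := h1.injective.comp π.symm.injective
      simpa [Function.comp_assoc] using this
    exact congrArg Fin.val (h4 (congrFun h3 i))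
  rw [Measure.map_apply hW hA]
  calc Measure.pi (fun _ : Fin n => expMeasure 1) A
      = ∑ π : Equiv.Perm (Fin n), P {ω | Y ω ∘ π ∈ S} := by
        rw [Finset.sum_congr rfl fun π _ => hperm π, Finset.sum_const, Finset.card_univ,
          Fintype.card_perm, Fintype.card_fin, nsmul_eq_mul, ← mul_assoc,
          ENNReal.mul_inv_cancel (by exact_mod_cast n.factorial_ne_zero)
            (ENNReal.natCast_ne_top _), one_mul]
    _ = P (⋃ π : Equiv.Perm (Fin n), {ω | Y ω ∘ π ∈ S}) := by
        rw [measure_iUnion hdisj fun π => (hcomp π).comp hY hSm, tsum_fintype]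
    _ ≤ P (W ⁻¹' A) := by
        refine measure_mono (Set.iUnion_subset fun π ω hω => ?_)
        rw [Set.mem_preimage, hYW ω π (hanti hω)]
        exact hω.1

end Renyi

/-! ### Order statistics: spacings and measurability. -/

section OrderStatistics

variable {N : ℕ}

lemma unifOrderStat_succ (x : Config N → ℝ) {i : ℕ} (h : i < 2 ^ N) :
    unifOrderStat x (i + 1) = cdf (gaussianReal 0 1) (x (sortedConfig x ⟨i, h⟩)) := by
  simp [unifOrderStat, h]

lemma unifOrderStat_pos (x : Config N → ℝ) {j : ℕ} (hj : 1 ≤ j) : 0 < unifOrderStat x j := by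
  obtain ⟨i, rfl⟩ : ∃ i, j = i + 1 := ⟨j - 1, by omega⟩
  by_cases h : i < 2 ^ N
  · rw [unifOrderStat_succ x h]; exact cdf_gaussianReal_pos _
  · simp [unifOrderStat, h]

lemma monotone_comp_sortedConfig (x : Config N → ℝ) : Monotone fun i => x (sortedConfig x i) :=
  Tuple.monotone_sort (x ∘ configEnum N)

/-- The convention that U is 1 beyond rank 2^N becomes extension by zero after taking logarithms. -/
lemma log_unifOrderStat (x : Config N → ℝ) (i : ℕ) :
    Real.log (unifOrderStat x (i + 1)) =
      -extendZero (fun i => -Real.log (cdf (gaussianReal 0 1) (x (sortedConfig x i)))) i := by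
  unfold extendZero
  split_ifs with h
  · rw [unifOrderStat_succ x h, neg_neg]
  · simp [unifOrderStat, h]

lemma expSpacing_eq (x : Config N → ℝ) (i : Fin (2 ^ N)) :
    expSpacing x (i + 1) = Matrix.toLin' (spacingMatrix (2 ^ N))
      (fun i => -Real.log (cdf (gaussianReal 0 1) (x (sortedConfig x i)))) i := by
  rw [expSpacing, spacingMatrix_mulVec, Real.log_div (unifOrderStat_pos x (by omega)).ne'
    (unifOrderStat_pos x (by omega)).ne', log_unifOrderStat x (i + 1), log_unifOrderStat x i]
  push_cast
  ring

/-- Sorting is decided by finitely many comparisons of coordinates; this yields the measurability of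
the order statistics. -/
lemma measurableSet_sort_eq (π : Equiv.Perm (Fin (2 ^ N))) :
    MeasurableSet {x : Config N → ℝ | π = Tuple.sort (x ∘ configEnum N)} := by
  have : {x : Config N → ℝ | π = Tuple.sort (x ∘ configEnum N)} =
      (⋂ i, ⋂ j, {x | i ≤ j → x (configEnum N (π i)) ≤ x (configEnum N (π j))}) ∩
      ⋂ i, ⋂ j, {x | i < j → x (configEnum N (π i)) = x (configEnum N (π j)) → π i < π j} := by
    ext x
    simp only [Set.mem_inter_iff, Set.mem_iInter, Set.mem_ofPred_eq]
    rw [Tuple.eq_sort_iff]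
    rfl
  rw [this]
  refine MeasurableSet.inter (.iInter fun i => .iInter fun j => ?_)
    (.iInter fun i => .iInter fun j => ?_)
  · exact (MeasurableSet.const _).imp
      (measurableSet_le (measurable_pi_apply _) (measurable_pi_apply _))
  · exact (MeasurableSet.const _).imp
      ((measurableSet_eq_fun (measurable_pi_apply (configEnum N (π i)))
        (measurable_pi_apply (configEnum N (π j)))).imp (MeasurableSet.const _))

lemma measurable_apply_sortedConfig (i : Fin (2 ^ N)) :
    Measurable fun x : Config N → ℝ => x (sortedConfig x i) := by
  intro s hs
  have : (fun x : Config N → ℝ => x (sortedConfig x i)) ⁻¹' s =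
      ⋃ π : Equiv.Perm (Fin (2 ^ N)), {x | π = Tuple.sort (x ∘ configEnum N)} ∩
        {x | x (configEnum N (π i)) ∈ s} := by
    ext x
    simp [sortedConfig]
  rw [this]
  exact .iUnion fun π => (measurableSet_sort_eq π).inter (measurable_pi_apply _ hs)

lemma measurable_expSpacing (i : Fin (2 ^ N)) :
    Measurable fun x : Config N → ℝ => expSpacing x (i + 1) := by
  simp_rw [expSpacing_eq]
  have hMm : Measurable (Matrix.toLin' (spacingMatrix (2 ^ N))) :=
    (LinearMap.continuous_on_pi _).measurable
  exact (measurable_pi_apply i).comp (hMm.comp (measurable_pi_lambda _ fun j =>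
    measurable_neg_log_cdf_gaussianReal.comp (measurable_apply_sortedConfig j)))

end OrderStatistics

/-! ### The spacings are i.i.d. exponential. -/

section Law

variable {Ω : Type*} [MeasurableSpace Ω] {P : Measure Ω} [IsProbabilityMeasure P] {N : ℕ}
  {X : Config N → Ω → ℝ}

lemma hasLaw_expSpacing_pi (hX : ∀ σ, Measurable (X σ))
    (hlaw : ∀ σ, P.map (X σ) = gaussianReal 0 1) (hind : iIndepFun X P) :
    P.map (fun ω (i : Fin (2 ^ N)) => expSpacing (fun σ => X σ ω) (i + 1)) =
      Measure.pi fun _ => expMeasure 1 := by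
  have hXm : Measurable fun ω σ => X σ ω := measurable_pi_lambda _ hX
  refine map_spacings_eq_pi_expMeasure
    (Y := fun ω i => -Real.log (cdf (gaussianReal 0 1) (X (configEnum N i) ω)))
    (measurable_pi_lambda _ fun i => measurable_neg_log_cdf_gaussianReal.comp (hX _))
    (measurable_pi_lambda _ fun i => (measurable_expSpacing i).comp hXm) ?_ ?_
  · have h1 := (hind.precomp (configEnum N).injective).comp
      (fun _ x => -Real.log (cdf (gaussianReal 0 1) x))
      fun _ => measurable_neg_log_cdf_gaussianReal
    have h2 := (iIndepFun_iff_map_fun_eq_pi_map fun i =>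
      (measurable_neg_log_cdf_gaussianReal.comp (hX (configEnum N i))).aemeasurable).1 h1
    refine h2.trans ?_
    congr
    ext1 i
    rw [← Measure.map_map measurable_neg_log_cdf_gaussianReal (hX _), hlaw,
      map_neg_log_cdf_gaussianReal]
  · intro ω π hπ
    have hmono : StrictMono ((fun σ => X σ ω) ∘ configEnum N ∘ π) := by
      intro i j hij
      have h3 := neg_lt_neg_iff.1 (hπ hij)
      exact strictMono_cdf_gaussianReal.lt_iff_lt.1
        ((Real.log_lt_log_iff (cdf_gaussianReal_pos _) (cdf_gaussianReal_pos _)).1 h3)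
    -- Strict monotonicity excludes ties, so the tie-breaking clause is vacuous.
    have hsort : π = Tuple.sort ((fun σ => X σ ω) ∘ configEnum N) :=
      Tuple.eq_sort_iff.2 ⟨hmono.monotone, fun i j hij h => absurd h (hmono hij).ne⟩
    funext i
    rw [expSpacing_eq]
    refine congrFun (congrArg _ (funext fun j => ?_)) i
    simp only [sortedConfig, ← hsort]
    rfl

lemma hasLaw_expSpacing (hX : ∀ σ, Measurable (X σ))
    (hlaw : ∀ σ, P.map (X σ) = gaussianReal 0 1) (hind : iIndepFun X P) {ℓ : ℕ}
    (hℓ : ℓ ∈ Finset.Icc 1 (2 ^ N)) :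
    HasLaw (fun ω => expSpacing (fun σ => X σ ω) ℓ) (expMeasure 1) P := by
  have := isProbabilityMeasure_expMeasure one_pos
  have hXm : Measurable fun ω σ => X σ ω := measurable_pi_lambda _ hX
  rw [Finset.mem_Icc] at hℓ
  obtain ⟨i, rfl⟩ : ∃ i : Fin (2 ^ N), ℓ = i + 1 := ⟨⟨ℓ - 1, by omega⟩, by simp; omega⟩
  refine ⟨((measurable_expSpacing i).comp hXm).aemeasurable, ?_⟩
  have h := congrArg (Measure.map fun y => y i) (hasLaw_expSpacing_pi hX hlaw hind)
  have hW : Measurable fun ω (i : Fin (2 ^ N)) => expSpacing (fun σ => X σ ω) (i + 1) :=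
    measurable_pi_lambda _ fun i => (measurable_expSpacing i).comp hXm
  rw [Measure.map_map (measurable_pi_apply i) hW,
    (measurePreserving_eval (fun _ : Fin (2 ^ N) => expMeasure 1) i).map_eq] at h
  exact h

lemma iIndepFun_expSpacing (hX : ∀ σ, Measurable (X σ))
    (hlaw : ∀ σ, P.map (X σ) = gaussianReal 0 1) (hind : iIndepFun X P) :
    iIndepFun (fun (ℓ : Finset.Icc 1 (2 ^ N)) (ω : Ω) =>
      expSpacing (fun σ => X σ ω) (ℓ : ℕ)) P := by
  have h : iIndepFun (fun (i : Fin (2 ^ N)) (ω : Ω) =>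
      expSpacing (fun σ => X σ ω) (i + 1)) P := by
    refine (iIndepFun_iff_hasLaw_pi_pi (μ := fun _ => expMeasure 1) fun i =>
      hasLaw_expSpacing hX hlaw hind (by rw [Finset.mem_Icc]; omega)).2 ⟨?_, ?_⟩
    · exact (measurable_pi_lambda _ fun i =>
        (measurable_expSpacing i).comp (measurable_pi_lambda _ hX)).aemeasurable
    · exact hasLaw_expSpacing_pi hX hlaw hind
  have hb (ℓ : Finset.Icc 1 (2 ^ N)) : 1 ≤ (ℓ : ℕ) ∧ (ℓ : ℕ) ≤ 2 ^ N := Finset.mem_Icc.1 ℓ.2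
  let g : Finset.Icc 1 (2 ^ N) → Fin (2 ^ N) := fun ℓ => ⟨ℓ - 1, by have := hb ℓ; omega⟩
  have hg : Function.Injective g := fun a b hab => by
    have h1 := hb a
    have h2 := hb b
    have h3 : (a : ℕ) - 1 = b - 1 := congrArg Fin.val hab
    exact Subtype.ext (by omega)
  have hgs (ℓ : Finset.Icc 1 (2 ^ N)) : (g ℓ : ℕ) + 1 = ℓ := by
    have := hb ℓ
    simp only [g]; omega
  have := h.precomp hg
  simpa only [Function.comp_def, hgs] using this

end Law

/-! ### Almost sure bounds on the order statistics. -/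

section OrderStatisticBounds

open scoped ENNReal

lemma gaussianReal_cdf_le_le (u : ℝ) :
    gaussianReal 0 1 {x | cdf (gaussianReal 0 1) x ≤ u} ≤ ENNReal.ofReal u := by
  rcases le_or_gt u 0 with h0 | h0
  · have : {x | cdf (gaussianReal 0 1) x ≤ u} = ∅ := by
      ext x
      simpa using h0.trans_lt (cdf_gaussianReal_pos x)
    simp [this]
  rcases le_or_gt 1 u with h1 | h1
  · exact prob_le_one.trans (by simpa using h1)
  · exact (gaussianReal_cdf_le h0 h1).le

lemma gaussianReal_lt_cdf_le (u : ℝ) :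
    gaussianReal 0 1 {x | u < cdf (gaussianReal 0 1) x} ≤ ENNReal.ofReal (Real.exp (-u)) := by
  rcases le_or_gt u 0 with h0 | h0
  · refine prob_le_one.trans ?_
    simpa using h0
  rcases le_or_gt 1 u with h1 | h1
  · have : {x | u < cdf (gaussianReal 0 1) x} = ∅ := by
      ext x
      simpa using (cdf_gaussianReal_lt_one x).le.trans h1
    simp [this]
  · have h : {x | u < cdf (gaussianReal 0 1) x} = {x | cdf (gaussianReal 0 1) x ≤ u}ᶜ := by
      ext x
      simp
    rw [h, prob_compl_eq_one_sub (measurableSet_le measurable_cdf_gaussianReal measurable_const),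
      gaussianReal_cdf_le h0 h1, ← ENNReal.ofReal_one, ← ENNReal.ofReal_sub _ h0.le]
    exact ENNReal.ofReal_le_ofReal (Real.one_sub_le_exp_neg u)

variable {Ω : Type*} [MeasurableSpace Ω] {P : Measure Ω} {N : ℕ}
  {X : Config N → Ω → ℝ}

/-- Union bound for `m` of the variables to lie in a set. -/
lemma measure_exists_card_eq_forall_mem_le (hX : ∀ σ, Measurable (X σ))
    (hlaw : ∀ σ, P.map (X σ) = gaussianReal 0 1) (hind : iIndepFun X P) (m : ℕ) {A : Set ℝ}
    (hA : MeasurableSet A) {q : ℝ} (hq0 : 0 ≤ q) (hq : gaussianReal 0 1 A ≤ ENNReal.ofReal q) :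
    P {ω | ∃ S : Finset (Config N), S.card = m ∧ ∀ σ ∈ S, X σ ω ∈ A} ≤
      ENNReal.ofReal ((2 ^ N).choose m * q ^ m) := by
  have hsub : {ω | ∃ S : Finset (Config N), S.card = m ∧ ∀ σ ∈ S, X σ ω ∈ A} ⊆
      ⋃ S ∈ (Finset.univ : Finset (Config N)).powersetCard m, ⋂ σ ∈ S, X σ ⁻¹' A := by
    rintro ω ⟨S, hS, h⟩
    simp only [Set.mem_iUnion, Set.mem_iInter]
    exact ⟨S, Finset.mem_powersetCard.2 ⟨Finset.subset_univ _, hS⟩, h⟩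
  calc _ ≤ _ := measure_mono hsub
    _ ≤ ∑ S ∈ (Finset.univ : Finset (Config N)).powersetCard m, P (⋂ σ ∈ S, X σ ⁻¹' A) :=
        measure_biUnion_finset_le _ _
    _ ≤ ∑ S ∈ (Finset.univ : Finset (Config N)).powersetCard m, ENNReal.ofReal q ^ m := by
        refine Finset.sum_le_sum fun S hS => ?_
        rw [hind.measure_inter_preimage_eq_mul S fun _ _ => hA]
        have hσ (σ : Config N) : P (X σ ⁻¹' A) ≤ ENNReal.ofReal q := by
          rwa [← Measure.map_apply (hX σ) hA, hlaw]
        refine (Finset.prod_le_prod' fun σ _ => hσ σ).trans ?_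
        rw [Finset.prod_const, (Finset.mem_powersetCard.1 hS).2]
    _ = _ := by
        rw [Finset.sum_const, Finset.card_powersetCard, Finset.card_univ, nsmul_eq_mul,
          ENNReal.ofReal_mul (by positivity), ENNReal.ofReal_pow hq0, ENNReal.ofReal_natCast]
        simp

lemma unifOrderStat_mono_succ (x : Config N → ℝ) {i j : ℕ} (hij : i ≤ j) (hj : j < 2 ^ N) :
    unifOrderStat x (i + 1) ≤ unifOrderStat x (j + 1) := by
  rw [unifOrderStat_succ x hj, unifOrderStat_succ x (hij.trans_lt hj)]
  exact strictMono_cdf_gaussianReal.monotone (monotone_comp_sortedConfig x (by simpa using hij))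

/-- On this event the j lowest variables all satisfy Φ(X_σ) ≤ p. -/
lemma measure_unifOrderStat_le (hX : ∀ σ, Measurable (X σ))
    (hlaw : ∀ σ, P.map (X σ) = gaussianReal 0 1) (hind : iIndepFun X P) {j : ℕ} (hj : 1 ≤ j)
    (hjN : j ≤ 2 ^ N) {p : ℝ} (hp : 0 ≤ p) :
    P {ω | unifOrderStat (fun σ => X σ ω) j ≤ p} ≤
      ENNReal.ofReal ((2 ^ N).choose j * p ^ j) := by
  refine (measure_mono ?_).trans (measure_exists_card_eq_forall_mem_le hX hlaw hind j
    (A := {x | cdf (gaussianReal 0 1) x ≤ p})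
    (measurableSet_le measurable_cdf_gaussianReal measurable_const) hp (gaussianReal_cdf_le_le p))
  intro ω hω
  obtain ⟨i, rfl⟩ : ∃ i, j = i + 1 := ⟨j - 1, by omega⟩
  refine ⟨(Finset.univ : Finset (Fin (i + 1))).map
    ((Fin.castLEEmb hjN).trans (sortedConfig fun σ => X σ ω).toEmbedding),
    by simp, fun σ hσ => ?_⟩
  simp only [Finset.mem_map, Finset.mem_univ, true_and] at hσ
  obtain ⟨l, rfl⟩ := hσ
  have h := unifOrderStat_mono_succ (fun σ => X σ ω) (Nat.lt_succ_iff.1 l.2) hjN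
  rw [unifOrderStat_succ _ (l.2.trans_le hjN)] at h
  exact h.trans hω

/-- On this event all variables of rank j or higher, m of them, satisfy Φ(X_σ) > t, each with
probability at most exp(-t). -/
lemma measure_lt_unifOrderStat (hX : ∀ σ, Measurable (X σ))
    (hlaw : ∀ σ, P.map (X σ) = gaussianReal 0 1) (hind : iIndepFun X P) {j m : ℕ} (hj : 1 ≤ j)
    (hjm : j + m = 2 ^ N + 1) (t : ℝ) :
    P {ω | t < unifOrderStat (fun σ => X σ ω) j} ≤
      ENNReal.ofReal ((2 ^ N).choose m * Real.exp (-t) ^ m) := by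
  refine (measure_mono ?_).trans (measure_exists_card_eq_forall_mem_le hX hlaw hind m
    (A := {x | t < cdf (gaussianReal 0 1) x})
    (measurableSet_lt measurable_const measurable_cdf_gaussianReal) (Real.exp_pos _).le
    (gaussianReal_lt_cdf_le t))
  intro ω hω
  obtain ⟨i, rfl⟩ : ∃ i, j = i + 1 := ⟨j - 1, by omega⟩
  have hlt (l : Fin m) : i + l < 2 ^ N := by omega
  refine ⟨(Finset.univ : Finset (Fin m)).map
    (Function.Embedding.trans ⟨fun l : Fin m => (⟨i + l, hlt l⟩ : Fin (2 ^ N)), fun a b hab => by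
      simpa [Fin.ext_iff] using hab⟩ (sortedConfig fun σ => X σ ω).toEmbedding),
    by simp, fun σ hσ => ?_⟩
  simp only [Finset.mem_map, Finset.mem_univ, true_and] at hσ
  obtain ⟨l, rfl⟩ := hσ
  have h := unifOrderStat_mono_succ (fun σ => X σ ω) (Nat.le_add_right i l) (hlt l)
  rw [unifOrderStat_succ _ (hlt l)] at h
  exact lt_of_lt_of_le hω h

/-- The almost sure properties of the order statistics used in the approximation. -/
structure Regular (K N : ℕ) (x : Config N → ℝ) : Prop where
  lower : 1 / (2 ^ N * ((N : ℝ) + 1) ^ 2) < unifOrderStat x 1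
  upper : unifOrderStat x 1 ≤ 2 * Real.log (N + 1) / 2 ^ N
  growth : ∀ j ∈ Finset.Icc 1 (2 ^ N), N ≤ j → (j : ℝ) / (16 * 2 ^ N) < unifOrderStat x j
  top : 1 ≤ K → 2 * K ≤ 2 ^ N → unifOrderStat x K ≤ 4 * K * N / 2 ^ N

lemma measure_not_lower (hX : ∀ σ, Measurable (X σ))
    (hlaw : ∀ σ, P.map (X σ) = gaussianReal 0 1) (hind : iIndepFun X P) :
    P {ω | ¬ 1 / (2 ^ N * ((N : ℝ) + 1) ^ 2) < unifOrderStat (fun σ => X σ ω) 1} ≤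
      ENNReal.ofReal (1 / ((N : ℝ) + 1) ^ 2) := by
  simp_rw [not_lt]
  refine (measure_unifOrderStat_le hX hlaw hind le_rfl Nat.one_le_two_pow (by positivity)).trans
    (ENNReal.ofReal_le_ofReal (le_of_eq ?_))
  rw [Nat.choose_one_right]
  push_cast
  field_simp

lemma measure_not_upper (hX : ∀ σ, Measurable (X σ))
    (hlaw : ∀ σ, P.map (X σ) = gaussianReal 0 1) (hind : iIndepFun X P) :
    P {ω | ¬ unifOrderStat (fun σ => X σ ω) 1 ≤ 2 * Real.log (N + 1) / 2 ^ N} ≤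
      ENNReal.ofReal (1 / ((N : ℝ) + 1) ^ 2) := by
  simp_rw [not_le]
  refine (measure_lt_unifOrderStat hX hlaw hind (m := 2 ^ N) le_rfl (by omega) _).trans (ENNReal.ofReal_le_ofReal (le_of_eq ?_))
  rw [Nat.choose_self, ← Real.exp_nat_mul]
  push_cast
  have : (2 : ℝ) ^ N * -(2 * Real.log (N + 1) / 2 ^ N) = -(Real.log ((N + 1) ^ 2)) := by
    rw [Real.log_pow]; push_cast; field_simp
  rw [this, Real.exp_neg, Real.exp_log (by positivity)]
  simp

lemma choose_mul_div_pow_le {n j : ℕ} (hn : 0 < n) :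
    (n.choose j : ℝ) * ((j : ℝ) / (16 * n)) ^ j ≤ (1 / 4) ^ j := by
  have hn' : (0 : ℝ) < n := by exact_mod_cast hn
  calc (n.choose j : ℝ) * ((j : ℝ) / (16 * n)) ^ j
      ≤ (n : ℝ) ^ j / j.factorial * ((j : ℝ) / (16 * n)) ^ j := by
        gcongr
        exact Nat.choose_le_pow_div j n
    _ = (j : ℝ) ^ j / j.factorial * (1 / 16) ^ j := by
        rw [div_pow, mul_pow, one_div, inv_pow]
        field_simp
    _ ≤ Real.exp j * (1 / 16) ^ j := by
        gcongr
        exact Real.pow_div_factorial_le_exp _ (by positivity) j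
    _ ≤ 4 ^ j * (1 / 16) ^ j := by
        gcongr
        rw [← mul_one (j : ℝ), Real.exp_nat_mul]
        gcongr
        linarith [Real.exp_one_lt_d9]
    _ = (1 / 4) ^ j := by rw [← mul_pow]; norm_num

lemma measure_not_growth (hX : ∀ σ, Measurable (X σ))
    (hlaw : ∀ σ, P.map (X σ) = gaussianReal 0 1) (hind : iIndepFun X P) :
    P {ω | ¬ ∀ j ∈ Finset.Icc 1 (2 ^ N), N ≤ j →
        (j : ℝ) / (16 * 2 ^ N) < unifOrderStat (fun σ => X σ ω) j} ≤
      ENNReal.ofReal (2 * (1 / 2) ^ N) := by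
  have hsub : {ω | ¬ ∀ j ∈ Finset.Icc 1 (2 ^ N), N ≤ j →
        (j : ℝ) / (16 * 2 ^ N) < unifOrderStat (fun σ => X σ ω) j} ⊆
      ⋃ j ∈ (Finset.Icc 1 (2 ^ N)).filter (N ≤ ·),
        {ω | unifOrderStat (fun σ => X σ ω) j ≤ (j : ℝ) / (16 * 2 ^ N)} := by
    intro ω hω
    simp only [Set.mem_ofPred_eq, not_forall, not_lt] at hω
    obtain ⟨j, h1, h2, h3⟩ := hω
    simp only [Set.mem_iUnion]
    exact ⟨j, Finset.mem_filter.2 ⟨h1, h2⟩, h3⟩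
  calc _ ≤ _ := measure_mono hsub
    _ ≤ _ := measure_biUnion_finset_le _ _
    _ ≤ ∑ j ∈ (Finset.Icc 1 (2 ^ N)).filter (N ≤ ·), ENNReal.ofReal ((1 / 2) ^ N * (1 / 2) ^ j) := by
        refine Finset.sum_le_sum fun j hj => ?_
        rw [Finset.mem_filter, Finset.mem_Icc] at hj
        refine (measure_unifOrderStat_le hX hlaw hind hj.1.1 hj.1.2 (by positivity)).trans
          (ENNReal.ofReal_le_ofReal ?_)
        have h := choose_mul_div_pow_le (n := 2 ^ N) (j := j) (by positivity)
        push_cast at h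
        refine h.trans ?_
        -- One factor (1/2)^j ≤ (1/2)^N gives decay in N; the other makes the sum over j converge.
        rw [show (1 / 4 : ℝ) = 1 / 2 * (1 / 2) by norm_num, mul_pow]
        gcongr ?_ * _
        exact pow_le_pow_of_le_one (by norm_num) (by norm_num) hj.2
    _ ≤ ENNReal.ofReal (2 * (1 / 2) ^ N) := by
        rw [← ENNReal.ofReal_sum_of_nonneg fun _ _ => by positivity, ← Finset.mul_sum, mul_comm 2]
        refine ENNReal.ofReal_le_ofReal ?_
        gcongr
        refine le_trans ?_ tsum_geometric_two.le
        exact summable_geometric_two.sum_le_tsum _ fun _ _ => by positivity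

lemma measure_not_top (hX : ∀ σ, Measurable (X σ))
    (hlaw : ∀ σ, P.map (X σ) = gaussianReal 0 1) (hind : iIndepFun X P) (K : ℕ) :
    P {ω | ¬ (1 ≤ K → 2 * K ≤ 2 ^ N →
        unifOrderStat (fun σ => X σ ω) K ≤ 4 * K * N / 2 ^ N)} ≤
      ENNReal.ofReal (Real.exp (-N)) := by
  by_cases hK : 1 ≤ K ∧ 2 * K ≤ 2 ^ N
  swap
  · have : {ω | ¬ (1 ≤ K → 2 * K ≤ 2 ^ N →
        unifOrderStat (fun σ => X σ ω) K ≤ 4 * K * N / 2 ^ N)} = ∅ := by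
      ext ω
      simp only [Set.mem_ofPred_eq, Set.mem_empty_iff_false, iff_false, not_not]
      exact fun h1 h2 => absurd ⟨h1, h2⟩ hK
    rw [this]
    simp
  obtain ⟨h1, h2⟩ := hK
  simp only [h1, h2, true_imp_iff, not_le]
  obtain ⟨m, hm⟩ : ∃ m, K + m = 2 ^ N + 1 := ⟨2 ^ N + 1 - K, by omega⟩
  refine (measure_lt_unifOrderStat hX hlaw hind h1 hm _).trans
    (ENNReal.ofReal_le_ofReal ?_)
  have hK1 : (1 : ℝ) ≤ K := by exact_mod_cast h1
  have hmR : (2 : ℝ) ^ N / 2 ≤ m := by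
    have : 2 ^ N ≤ 2 * m := by omega
    have : ((2 : ℝ) ^ N) ≤ 2 * m := by exact_mod_cast this
    linarith
  -- By symmetry this is the binomial coefficient of K - 1, hence at most 2^{NK}.
  have hch : ((2 ^ N).choose m : ℝ) ≤ Real.exp (K * N) := by
    have hle : (2 ^ N).choose m ≤ (2 ^ N) ^ K := by
      rw [← Nat.choose_symm (by omega)]
      exact (Nat.choose_le_pow _ _).trans (Nat.pow_le_pow_right (by positivity) (by omega))
    calc ((2 ^ N).choose m : ℝ) ≤ ((2 : ℝ) ^ N) ^ K := by exact_mod_cast hle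
      _ ≤ (Real.exp 1 ^ N) ^ K := by
        gcongr
        linarith [Real.exp_one_gt_d9]
      _ = Real.exp (K * N) := by
        rw [← pow_mul, ← Real.exp_nat_mul]; push_cast; ring_nf
  have hexp : Real.exp (-(4 * K * N / 2 ^ N)) ^ m ≤ Real.exp (-(2 * K * N)) := by
    rw [← Real.exp_nat_mul, Real.exp_le_exp]
    have : (2 : ℝ) ^ N / 2 * (4 * K * N / 2 ^ N) ≤ m * (4 * K * N / 2 ^ N) := by gcongr
    have h3 : (2 : ℝ) ^ N / 2 * (4 * K * N / 2 ^ N) = 2 * K * N := by field_simp; ring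
    linarith
  calc _ ≤ Real.exp (K * N) * Real.exp (-(2 * K * N)) := by gcongr
    _ = Real.exp (-(K * N)) := by rw [← Real.exp_add]; ring_nf
    _ ≤ _ := by
      rw [Real.exp_le_exp]
      nlinarith [Nat.cast_nonneg (α := ℝ) N]

lemma summable_exceptional_bound :
    Summable fun N : ℕ => 1 / ((N : ℝ) + 1) ^ 2 + 1 / ((N : ℝ) + 1) ^ 2 + 2 * (1 / 2) ^ N
      + Real.exp (-N) := by
  have h1 : Summable fun N : ℕ => 1 / ((N : ℝ) + 1) ^ 2 := by
    have := (summable_nat_add_iff 1).2 (Real.summable_one_div_nat_pow.2 one_lt_two)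
    simpa using this
  exact ((h1.add h1).add (summable_geometric_two.mul_left 2)).add Real.summable_exp_neg_nat

lemma ae_eventually_regular {X : (N : ℕ) → Config N → Ω → ℝ} (hX : ∀ N σ, Measurable (X N σ))
    (hlaw : ∀ N σ, P.map (X N σ) = gaussianReal 0 1) (hind : ∀ N, iIndepFun (X N) P)
    (k : ℕ → ℕ) : ∀ᵐ ω ∂P, ∀ᶠ N in atTop, Regular (k N) N fun σ => X N σ ω := by
  have hle (N : ℕ) : P {ω | ¬ Regular (k N) N fun σ => X N σ ω} ≤
      ENNReal.ofReal (1 / ((N : ℝ) + 1) ^ 2 + 1 / ((N : ℝ) + 1) ^ 2 + 2 * (1 / 2) ^ N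
        + Real.exp (-N)) := by
    rw [ENNReal.ofReal_add (by positivity) (by positivity),
      ENNReal.ofReal_add (by positivity) (by positivity),
      ENNReal.ofReal_add (by positivity) (by positivity)]
    refine le_trans ?_ (add_le_add (add_le_add (add_le_add
      (measure_not_lower (hX N) (hlaw N) (hind N)) (measure_not_upper (hX N) (hlaw N) (hind N)))
      (measure_not_growth (hX N) (hlaw N) (hind N)))
      (measure_not_top (hX N) (hlaw N) (hind N) (k N)))
    refine (measure_mono ?_).trans ((measure_union_le _ _).trans (add_le_add_left
      ((measure_union_le _ _).trans (add_le_add_left (measure_union_le _ _) _)) _))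
    intro ω hω
    by_contra hcon
    simp only [Set.mem_union, Set.mem_ofPred_eq, not_or, not_not] at hcon
    exact hω ⟨hcon.1.1.1, hcon.1.1.2, hcon.1.2, hcon.2⟩
  have hsum : ∑' N, P {ω | ¬ Regular (k N) N fun σ => X N σ ω} ≠ ∞ :=
    ne_top_of_le_ne_top summable_exceptional_bound.tsum_ofReal_ne_top (ENNReal.tsum_le_tsum hle)
  filter_upwards [ae_eventually_notMem hsum] with ω hω
  filter_upwards [hω] with N hN
  simpa using hN

end OrderStatisticBounds

/-! ### Reduction of total variation to unnormalized weights. -/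

section TotalVariation

variable {N : ℕ}

lemma dTV_le_sum_abs (μ ν : Config N → ℝ) : dTV μ ν ≤ ∑ σ, |μ σ - ν σ| := by
  refine Real.iSup_le (fun Ψ => ?_) (Finset.sum_nonneg fun _ _ => abs_nonneg _)
  rw [expect, expect, ← Finset.sum_sub_distrib]
  refine (Finset.abs_sum_le_sum_abs _ _).trans (Finset.sum_le_sum fun σ _ => ?_)
  rw [← mul_sub, abs_mul]
  have h : |Ψ.1 σ| ≤ 1 := by
    rw [← Real.norm_eq_abs]
    exact (norm_le_pi_norm Ψ.1 σ).trans Ψ.2.le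
  exact mul_le_of_le_one_left (abs_nonneg _) h

/-- The normalizations differ by at most the ℓ¹ distance of the weights, whence the factor 2. Only
the normalization of `u` is left in the denominator. -/
lemma sum_abs_normalized_sub_le {ι : Type*} [Fintype ι] {w u : ι → ℝ} (hw : ∀ i, 0 ≤ w i)
    (hZ : 0 < ∑ i, w i) (hZ' : 0 < ∑ i, u i) :
    ∑ i, |w i / ∑ j, w j - u i / ∑ j, u j| ≤ 2 * (∑ i, |w i - u i|) / ∑ j, u j := by
  set Z := ∑ i, w i with hZd
  set Z' := ∑ i, u i with hZd'
  have hpt (i : ι) : |w i / Z - u i / Z'| ≤ |w i - u i| / Z' + w i * (|Z' - Z| / (Z * Z')) := by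
    have h : w i / Z - u i / Z' = (w i - u i) / Z' + w i * ((Z' - Z) / (Z * Z')) := by
      field_simp
      ring
    rw [h]
    refine (abs_add_le _ _).trans (le_of_eq ?_)
    rw [abs_div, abs_mul, abs_div, abs_of_pos hZ', abs_of_nonneg (hw i),
      abs_of_pos (mul_pos hZ hZ')]
  have hd : |Z' - Z| ≤ ∑ i, |w i - u i| := by
    rw [abs_sub_comm, hZd, hZd', ← Finset.sum_sub_distrib]
    exact Finset.abs_sum_le_sum_abs _ _
  calc _ ≤ ∑ i, (|w i - u i| / Z' + w i * (|Z' - Z| / (Z * Z'))) :=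
        Finset.sum_le_sum fun i _ => hpt i
    _ = (∑ i, |w i - u i|) / Z' + |Z' - Z| / Z' := by
        rw [Finset.sum_add_distrib, ← Finset.sum_div, ← Finset.sum_mul, ← hZd]
        field_simp
    _ ≤ (∑ i, |w i - u i|) / Z' + (∑ i, |w i - u i|) / Z' := by gcongr
    _ = _ := by ring

/-- The log-ratio `log (U_{i+1} / U_1)`. -/
noncomputable def logRatio (x : Config N → ℝ) (i : ℕ) : ℝ :=
  Real.log (unifOrderStat x (i + 1)) - Real.log (unifOrderStat x 1)

lemma sum_expSpacing_div (x : Config N → ℝ) (i : ℕ) :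
    ∑ ℓ ∈ Finset.Icc 1 i, expSpacing x ℓ / (ℓ : ℝ) = logRatio x i := by
  induction i with
  | zero => simp [logRatio]
  | succ i ih =>
    rw [Finset.sum_Icc_succ_top (by omega), ih, expSpacing, logRatio, logRatio,
      Real.log_div (unifOrderStat_pos x (by omega)).ne' (unifOrderStat_pos x (by omega)).ne']
    field_simp
    ring

lemma approxWeight_sortedConfig (K : ℕ) (β : ℝ) (x : Config N → ℝ) (i : Fin (2 ^ N)) :
    approxWeight K β x (expSpacing x) (sortedConfig x i) =
      if (i : ℕ) < K then Real.exp (-(β / betaC) * logRatio x i) else 0 := by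
  rw [approxWeight, Equiv.symm_apply_apply, sum_expSpacing_div]

/-- The lowest energy level, up to the factor `√N`. -/
noncomputable def lowest (x : Config N → ℝ) : ℝ := x (sortedConfig x ⟨0, by positivity⟩)

/-- Gibbs weights, normalized to be `1` at the ground state. -/
noncomputable def shiftedWeight (β : ℝ) (x : Config N → ℝ) (σ : Config N) : ℝ :=
  Real.exp (-β * (Real.sqrt N * (x σ - lowest x)))

lemma gibbs_eq_shiftedWeight_div (β : ℝ) (x : Config N → ℝ) (σ : Config N) :
    gibbs β x σ = shiftedWeight β x σ / ∑ τ, shiftedWeight β x τ := by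
  have h (τ : Config N) : Real.exp (-β * hamiltonian x τ) =
      Real.exp (-β * (Real.sqrt N * lowest x)) * shiftedWeight β x τ := by
    rw [shiftedWeight, ← Real.exp_add, hamiltonian]
    ring_nf
  rw [gibbs, partitionFunction, h σ, Finset.sum_congr rfl fun τ _ => h τ, ← Finset.mul_sum,
    mul_div_mul_left _ _ (Real.exp_pos _).ne']

/-- Both families of weights equal 1 at the ground state, which bounds the approximate normalization
from below. -/
lemma dTV_gibbs_approxGibbs_le {K : ℕ} (hK : 1 ≤ K) (β : ℝ) (x : Config N → ℝ) :
    1 ≤ ∑ i : Fin (2 ^ N), (if (i : ℕ) < K then Real.exp (-(β / betaC) * logRatio x i) else 0) ∧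
    dTV (gibbs β x) (approxGibbs K β x (expSpacing x)) ≤
      2 * (∑ i : Fin (2 ^ N), |Real.exp (-β * (Real.sqrt N * (x (sortedConfig x i) - lowest x))) -
        if (i : ℕ) < K then Real.exp (-(β / betaC) * logRatio x i) else 0|) /
      ∑ i : Fin (2 ^ N), if (i : ℕ) < K then Real.exp (-(β / betaC) * logRatio x i) else 0 := by
  have hZ : 1 ≤ ∑ i : Fin (2 ^ N),
      (if (i : ℕ) < K then Real.exp (-(β / betaC) * logRatio x i) else 0) := by
    refine le_trans ?_ (Finset.single_le_sum (fun i _ => ?_)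
      (Finset.mem_univ (⟨0, by positivity⟩ : Fin (2 ^ N))))
    · simp [logRatio, show 0 < K from hK]
    · split_ifs <;> positivity
  refine ⟨hZ, (dTV_le_sum_abs _ _).trans ?_⟩
  have hu : ∑ τ, approxWeight K β x (expSpacing x) τ =
      ∑ i : Fin (2 ^ N), if (i : ℕ) < K then Real.exp (-(β / betaC) * logRatio x i) else 0 := by
    rw [← (sortedConfig x).sum_comp]
    exact Finset.sum_congr rfl fun i _ => approxWeight_sortedConfig K β x i
  have h := sum_abs_normalized_sub_le (w := shiftedWeight β x)
    (u := approxWeight K β x (expSpacing x)) (fun σ => (Real.exp_pos _).le)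
    (Finset.sum_pos (fun σ _ => Real.exp_pos _) Finset.univ_nonempty) (by rw [hu]; linarith)
  rw [hu, ← (sortedConfig x).sum_comp
    (fun σ => |shiftedWeight β x σ - approxWeight K β x (expSpacing x) σ|)] at h
  simp only [gibbs_eq_shiftedWeight_div, approxGibbs, hu]
  refine h.trans (le_of_eq ?_)
  simp only [approxWeight_sortedConfig, shiftedWeight]

end TotalVariation

/-! ### Comparison of exponential weights and tail sums. -/

section Sums

/-- Discrete form of the comparison with the integral of t^{-(1+s)} over [m, m+1]; the right side
telescopes. -/
lemma rpow_neg_succ_le {s : ℝ} (hs : 0 < s) {m : ℕ} (hm : 1 ≤ m) :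
    ((m : ℝ) + 1) ^ (-(1 + s)) ≤ ((m : ℝ) ^ (-s) - ((m : ℝ) + 1) ^ (-s)) / s := by
  have hm' : (0 : ℝ) < m := by exact_mod_cast hm
  have hm1 : (0 : ℝ) < (m : ℝ) + 1 := by positivity
  rw [le_div_iff₀ hs]
  have h1 : (m : ℝ) ^ (-s) = ((m : ℝ) + 1) ^ (-s) * Real.exp (-s * Real.log (m / (m + 1))) := by
    rw [Real.rpow_def_of_pos hm', Real.rpow_def_of_pos hm1, ← Real.exp_add,
      Real.log_div hm'.ne' hm1.ne']
    ring_nf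
  have h2 : Real.log (m / (m + 1)) ≤ -(1 / ((m : ℝ) + 1)) := by
    refine (Real.log_le_sub_one_of_pos (by positivity)).trans (le_of_eq ?_)
    field_simp
    ring
  have h3 : 1 + s * (1 / ((m : ℝ) + 1)) ≤ Real.exp (-s * Real.log (m / (m + 1))) := by
    refine le_trans ?_ (Real.add_one_le_exp _)
    nlinarith
  have h4 : ((m : ℝ) + 1) ^ (-(1 + s)) = ((m : ℝ) + 1) ^ (-s) * (1 / ((m : ℝ) + 1)) := by
    rw [show -(1 + s) = -s + -1 by ring, Real.rpow_add hm1, Real.rpow_neg_one, one_div]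
  have h5 := mul_le_mul_of_nonneg_left h3 (Real.rpow_nonneg hm1.le (-s))
  rw [h1, h4]
  linarith

lemma sum_Ico_rpow_neg_le {s : ℝ} (hs : 0 < s) {M : ℕ} (hM : 1 ≤ M) (n : ℕ) :
    ∑ i ∈ Finset.Ico M n, ((i : ℝ) + 1) ^ (-(1 + s)) ≤ (M : ℝ) ^ (-s) / s := by
  rcases le_total n M with h | h
  · rw [Finset.Ico_eq_empty_of_le h, Finset.sum_empty]; positivity
  have key : ∑ i ∈ Finset.Ico M n, ((i : ℝ) + 1) ^ (-(1 + s)) ≤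
      ((M : ℝ) ^ (-s) - (n : ℝ) ^ (-s)) / s := by
    induction n, h using Nat.le_induction with
    | base => simp
    | succ n hn ih =>
      rw [Finset.sum_Ico_succ_top hn]
      have := rpow_neg_succ_le hs (hM.trans hn)
      push_cast
      calc _ ≤ _ := add_le_add ih this
        _ = _ := by ring
  refine key.trans ?_
  gcongr
  have : (0 : ℝ) ≤ (n : ℝ) ^ (-s) := by positivity
  linarith

/-- Tail sums of `exp (-(1 + s) g)` for a sequence `g` growing at least logarithmically. -/
lemma sum_exp_neg_tail_le {s l : ℝ} (hs : 0 < s) (hl : 0 < l) {M n : ℕ} (hM : 1 ≤ M)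
    {g : ℕ → ℝ} (hg : ∀ i, M ≤ i → i < n → Real.exp (-g i) ≤ l / (i + 1)) :
    ∑ i : Fin n, (if M ≤ (i : ℕ) then Real.exp (-(1 + s) * g i) else 0) ≤
      l ^ (1 + s) * ((M : ℝ) ^ (-s) / s) := by
  rw [Fin.sum_univ_eq_sum_range (fun i : ℕ => if M ≤ i then Real.exp (-(1 + s) * g i) else 0),
    ← Finset.sum_filter]
  have hI : (Finset.range n).filter (M ≤ ·) = Finset.Ico M n := by
    ext i; simp; tauto
  rw [hI]
  refine le_trans (Finset.sum_le_sum fun i hi => ?_)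
    (le_trans (Finset.mul_sum _ _ _).ge
      (mul_le_mul_of_nonneg_left (sum_Ico_rpow_neg_le hs hM n) (by positivity)))
  rw [Finset.mem_Ico] at hi
  have h1 : Real.exp (-(1 + s) * g i) = Real.exp (-g i) ^ (1 + s) := by
    rw [← Real.exp_mul]; ring_nf
  have hi0 : (0 : ℝ) < (i : ℝ) + 1 := by positivity
  rw [h1, Real.rpow_neg hi0.le, ← div_eq_mul_inv, ← Real.div_rpow hl.le hi0.le]
  exact Real.rpow_le_rpow (Real.exp_pos _).le (hg i hi.1 hi.2) (by linarith)

lemma abs_exp_neg_sub_exp_neg_le {s t m : ℝ} (hs : m ≤ s) (ht : m ≤ t) :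
    |Real.exp (-s) - Real.exp (-t)| ≤ |s - t| * Real.exp (-m) := by
  wlog h : s ≤ t generalizing s t
  · rw [abs_sub_comm, abs_sub_comm s]
    exact this ht hs (le_of_not_ge h)
  have h1 : Real.exp (-t) = Real.exp (-s) * Real.exp (s - t) := by
    rw [← Real.exp_add]; ring_nf
  have h2 := Real.add_one_le_exp (s - t)
  have h3 : Real.exp (-s) ≤ Real.exp (-m) := Real.exp_le_exp.2 (by linarith)
  have h4 : Real.exp (-t) ≤ Real.exp (-s) := Real.exp_le_exp.2 (by linarith)
  rw [abs_of_nonneg (by linarith), abs_of_nonpos (by linarith), h1]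
  calc Real.exp (-s) - Real.exp (-s) * Real.exp (s - t)
      = Real.exp (-s) * (1 - Real.exp (s - t)) := by ring
    _ ≤ Real.exp (-s) * (t - s) :=
        mul_le_mul_of_nonneg_left (by linarith) (Real.exp_pos _).le
    _ ≤ Real.exp (-m) * (t - s) := by
        exact mul_le_mul_of_nonneg_right h3 (by linarith)
    _ = _ := by ring

/-- Comparison of the weights `exp (-b D i)` and `exp (-b g i)` when `D` is close to `g`. -/
lemma sum_abs_exp_sub_exp_le {n K : ℕ} {b δ η Λ : ℝ} {D : Fin n → ℝ} {g : ℕ → ℝ} (hη : 0 < η)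
    (hb : b = 1 + 4 * η) (hδ : 0 ≤ δ) (hbδ : b * δ ≤ η) (hΛ : 0 ≤ Λ)
    (hg : ∀ i : Fin n, 0 ≤ g i) (hD : ∀ i : Fin n, (1 - δ) * g i ≤ D i)
    (hD' : ∀ i : Fin n, (i : ℕ) < K → D i ≤ (1 + δ) * g i) :
    ∑ i : Fin n, |Real.exp (-b * D i) - if (i : ℕ) < K then Real.exp (-b * g i) else 0| ≤
      b * δ * Λ * Real.exp (b * δ * Λ) *
        ∑ i : Fin n, (if (i : ℕ) < K then Real.exp (-b * g i) else 0) +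
      b * δ / η * ∑ i : Fin n, (if Λ < g i then Real.exp (-(1 + 2 * η) * g i) else 0) +
      ∑ i : Fin n, (if K ≤ (i : ℕ) then Real.exp (-(1 + 3 * η) * g i) else 0) := by
  have hb0 : 0 < b := by linarith
  rw [Finset.mul_sum, Finset.mul_sum, ← Finset.sum_add_distrib, ← Finset.sum_add_distrib]
  refine Finset.sum_le_sum fun i _ => ?_
  have hgi := hg i
  -- Of the excess 4η of b over 1, the perturbation bδ consumes at most one η.
  have hlow : (1 + 3 * η) * g i ≤ b * ((1 - δ) * g i) := by nlinarith
  have hbD : b * ((1 - δ) * g i) ≤ b * D i := mul_le_mul_of_nonneg_left (hD i) hb0.le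
  by_cases hi : (i : ℕ) < K
  · rw [if_pos hi, if_neg (not_le.2 hi), add_zero]
    have hbg : b * ((1 - δ) * g i) ≤ b * g i := by
      have := mul_nonneg (mul_nonneg hb0.le hδ) hgi
      nlinarith
    have h1 := abs_exp_neg_sub_exp_neg_le hbD hbg
    have h2 : |b * D i - b * g i| ≤ b * δ * g i := by
      have h3 := mul_le_mul_of_nonneg_left (hD' i hi) hb0.le
      rw [abs_le]
      constructor <;> nlinarith
    have h4 : |Real.exp (-b * D i) - Real.exp (-b * g i)| ≤
        b * δ * g i * Real.exp (-(b * ((1 - δ) * g i))) := by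
      rw [neg_mul, neg_mul]
      exact h1.trans (mul_le_mul_of_nonneg_right h2 (Real.exp_pos _).le)
    refine h4.trans ?_
    by_cases hΛi : Λ < g i
    · rw [if_pos hΛi]
      refine le_add_of_nonneg_of_le (by positivity) ?_
      -- A second η pays for the linear factor g, leaving the exponent 1 + 2η.
      have h5 : g i ≤ Real.exp (η * g i) / η := by
        rw [le_div_iff₀ hη]
        linarith [Real.add_one_le_exp (η * g i)]
      calc b * δ * g i * Real.exp (-(b * ((1 - δ) * g i)))
          ≤ b * δ * (Real.exp (η * g i) / η) * Real.exp (-((1 + 3 * η) * g i)) := by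
            gcongr
        _ = b * δ / η * (Real.exp (η * g i) * Real.exp (-((1 + 3 * η) * g i))) := by ring
        _ = _ := by rw [← Real.exp_add]; ring_nf
    · rw [if_neg hΛi, mul_zero, add_zero]
      have hle := not_lt.1 hΛi
      calc b * δ * g i * Real.exp (-(b * ((1 - δ) * g i)))
          = b * δ * g i * (Real.exp (b * δ * g i) * Real.exp (-b * g i)) := by
            rw [← Real.exp_add]; ring_nf
        _ ≤ b * δ * Λ * (Real.exp (b * δ * Λ) * Real.exp (-b * g i)) := by gcongr
        _ = _ := by ring
  · rw [if_neg hi, if_pos (not_lt.1 hi), mul_zero, zero_add, sub_zero, abs_of_pos (Real.exp_pos _)]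
    refine le_add_of_nonneg_of_le (by split_ifs <;> positivity) (Real.exp_le_exp.2 ?_)
    linarith

/-- The contribution of the indices with `g` large, for `g` growing at least logarithmically. -/
lemma sum_exp_neg_large_le {s l : ℝ} (hs : 0 < s) (hl : 0 < l) {M n : ℕ} (hM : 1 ≤ M)
    {g : ℕ → ℝ} (hg : ∀ i, M ≤ i → i < n → Real.exp (-g i) ≤ l / (i + 1)) :
    ∑ i : Fin n, (if Real.log M < g i then Real.exp (-(1 + s) * g i) else 0) ≤
      (M : ℝ) ^ (-s) + l ^ (1 + s) * ((M : ℝ) ^ (-s) / s) := by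
  have hM0 : (0 : ℝ) < M := by exact_mod_cast hM
  -- No growth is known below index M, but there are at most M such terms, each below M^{-(1+s)} by
  -- the threshold on g.
  have hpt (i : Fin n) : (if Real.log M < g i then Real.exp (-(1 + s) * g i) else 0) ≤
      (if (i : ℕ) < M then (M : ℝ) ^ (-(1 + s)) else 0) +
        if M ≤ (i : ℕ) then Real.exp (-(1 + s) * g i) else 0 := by
    have hc : (0 : ℝ) ≤ (M : ℝ) ^ (-(1 + s)) := by positivity
    by_cases hi : (i : ℕ) < M
    · rw [if_pos hi, if_neg (not_le.2 hi), add_zero]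
      split_ifs with h
      · rw [Real.rpow_def_of_pos hM0, Real.exp_le_exp]
        nlinarith
      · exact hc
    · rw [if_neg hi, if_pos (not_lt.1 hi), zero_add]
      split_ifs <;> first | exact le_rfl | positivity
  refine (Finset.sum_le_sum fun i _ => hpt i).trans ?_
  rw [Finset.sum_add_distrib]
  refine add_le_add ?_ (sum_exp_neg_tail_le hs hl hM hg)
  rw [Fin.sum_univ_eq_sum_range (fun i : ℕ => if i < M then (M : ℝ) ^ (-(1 + s)) else 0),
    ← Finset.sum_filter, Finset.sum_const, nsmul_eq_mul]
  have hcard : (((Finset.range n).filter (· < M)).card : ℝ) ≤ M := by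
    have : ((Finset.range n).filter (· < M)).card ≤ (Finset.range M).card :=
      Finset.card_le_card fun i hi => by simp at hi ⊢; exact hi.2
    rw [Finset.card_range] at this
    exact_mod_cast this
  calc _ ≤ (M : ℝ) * (M : ℝ) ^ (-(1 + s)) := by gcongr
    _ = (M : ℝ) ^ (-s) := by
      rw [← Real.rpow_one_add' hM0.le (by linarith)]
      ring_nf

end Sums

/-! ### The inverse Mills ratio at the extreme levels. -/

lemma betaC_pos : 0 < betaC := Real.sqrt_pos.2 (by positivity)

lemma betaC_sq : betaC ^ 2 = 2 * Real.log 2 := Real.sq_sqrt (by positivity)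

lemma betaC_mul_sqrt_sq (N : ℕ) : (betaC * Real.sqrt N) ^ 2 = 2 * Real.log 2 * N := by
  rw [mul_pow, betaC_sq, Real.sq_sqrt (Nat.cast_nonneg N)]

lemma inv_sqrt_two_pi_le_one : (Real.sqrt (2 * Real.pi))⁻¹ ≤ 1 := by
  apply inv_le_one_of_one_le₀
  rw [Real.one_le_sqrt]
  linarith [Real.pi_gt_three]

/-- Upper bound of the inverse Mills ratio at the level of the ground state. -/
lemma invMills_le_of_lower {N K : ℕ} {x : ℝ} (hN : 1 ≤ N) (hNK : N + 1 ≤ K) (hK : 4 ≤ K)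
    (hx : x ≤ -1) (hΦ : 1 / (2 ^ N * ((N : ℝ) + 1) ^ 2) < cdf (gaussianReal 0 1) x) :
    invMills x ≤ betaC * Real.sqrt N * (1 + 4 * Real.log K / N) := by
  have hN0 : (0 : ℝ) < N := by exact_mod_cast hN
  set a := betaC * Real.sqrt N with ha
  have ha2 : a ^ 2 = 2 * Real.log 2 * N := betaC_mul_sqrt_sq N
  have ha0 : 0 ≤ a := mul_nonneg betaC_pos.le (Real.sqrt_nonneg _)
  have hL1 : 1 ≤ Real.log K := by
    rw [Real.le_log_iff_exp_le (by positivity)]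
    have : (4 : ℝ) ≤ K := by exact_mod_cast hK
    linarith [Real.exp_one_lt_d9]
  have hNL : Real.log (N + 1) ≤ Real.log K :=
    Real.log_le_log (by positivity) (by exact_mod_cast hNK)
  have hcdf : cdf (gaussianReal 0 1) x ≤ Real.exp (-x ^ 2 / 2) := by
    have h1 := neg_mul_cdf_gaussianReal_le x
    have h2 : gaussianPDFReal 0 1 x ≤ Real.exp (-x ^ 2 / 2) := by
      rw [gaussianPDFReal_zero_one]
      exact mul_le_of_le_one_left (Real.exp_pos _).le inv_sqrt_two_pi_le_one
    nlinarith [cdf_gaussianReal_pos x]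
  have hx2 : x ^ 2 ≤ 2 * Real.log 2 * N + 4 * Real.log K := by
    have h1 := Real.log_le_log (by positivity) (hΦ.le.trans hcdf)
    rw [Real.log_exp, Real.log_div one_ne_zero (by positivity), Real.log_one,
      Real.log_mul (by positivity) (by positivity), Real.log_pow, Real.log_pow] at h1
    push_cast at h1
    linarith
  have hsq : ((1 + x ^ 2) / (-x)) ^ 2 ≤ x ^ 2 + 3 := by
    rw [div_pow, div_le_iff₀ (by nlinarith)]
    nlinarith
  refine (invMills_le (by linarith)).trans (abs_le_of_sq_le_sq' ?_ (by positivity)).2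
  -- The surplus 4 log K + 3 of x² + 3 over a² is at most 7 log K, below 2 a² δ = 16 (log 2)(log K).
  have hδ : a ^ 2 * (4 * Real.log K / N) = 8 * Real.log 2 * Real.log K := by
    rw [ha2]; field_simp; ring
  have hl2 := Real.log_two_gt_d9
  calc ((1 + x ^ 2) / (-x)) ^ 2 ≤ x ^ 2 + 3 := hsq
    _ ≤ a ^ 2 + 2 * (a ^ 2 * (4 * Real.log K / N)) := by rw [hδ]; nlinarith
    _ ≤ a ^ 2 + 2 * (a ^ 2 * (4 * Real.log K / N)) + (a * (4 * Real.log K / N)) ^ 2 := by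
        linarith [sq_nonneg (a * (4 * Real.log K / N))]
    _ = _ := by ring

/-- Lower bound of the inverse Mills ratio at the `K`-th level. -/
lemma le_invMills_of_top {N K : ℕ} {x : ℝ} (hN : 1000 ≤ N) (hNK : N + 1 ≤ K)
    (hKN : 12 * Real.log K ≤ N) (hx : x ≤ -1)
    (hΦ : cdf (gaussianReal 0 1) x ≤ 4 * K * N / 2 ^ N) :
    betaC * Real.sqrt N ≤ invMills x * (1 + 4 * Real.log K / N) := by
  have hNR : (1000 : ℝ) ≤ N := by exact_mod_cast hN
  have hN0 : (0 : ℝ) < N := by linarith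
  have hNKR : (N : ℝ) + 1 ≤ K := by exact_mod_cast hNK
  have hK0 : (0 : ℝ) < K := by linarith
  set a := betaC * Real.sqrt N with ha
  have ha2 : a ^ 2 = 2 * Real.log 2 * N := betaC_mul_sqrt_sq N
  have hL0 : 0 ≤ Real.log K := Real.log_nonneg (by linarith)
  set δ := 4 * Real.log K / N with hδ
  have hδ0 : 0 ≤ δ := by positivity
  have hl2 := Real.log_two_gt_d9
  have hl2' := Real.log_two_lt_d9
  have hM := neg_le_invMills x
  -- If -x ≥ a, the bound -x ≤ φ/Φ suffices; otherwise -x < a controls the density φ(x) by Φ(x).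
  rcases le_or_gt a (-x) with hax | hax
  · nlinarith [invMills_pos x]
  have hpi : Real.sqrt (2 * Real.pi) ≤ 3 := by
    rw [Real.sqrt_le_left (by norm_num)]
    linarith [Real.pi_lt_d2]
  -- Amounts to 1152 log 2 ≤ N, which N ≥ 1000 ensures.
  have ha24 : 24 * a ≤ N := by
    refine (abs_le_of_sq_le_sq' ?_ hN0.le).2
    rw [mul_pow, ha2]
    nlinarith
  have hexp : Real.exp (-x ^ 2 / 2) ≤ K ^ 3 / 2 ^ N := by
    have h1 := neg_mul_gaussianPDFReal_le (x := x) (by linarith)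
    have h2 : gaussianPDFReal 0 1 x ≤ 2 * (-x) * cdf (gaussianReal 0 1) x := by
      have h3 : (1 + x ^ 2) * cdf (gaussianReal 0 1) x ≤
          -x * (2 * (-x) * cdf (gaussianReal 0 1) x) := by
        calc _ ≤ 2 * x ^ 2 * cdf (gaussianReal 0 1) x := by
              gcongr
              · exact (cdf_gaussianReal_pos x).le
              · nlinarith
          _ = _ := by ring
      exact le_of_mul_le_mul_left (h1.trans h3) (by linarith)
    rw [gaussianPDFReal_zero_one, inv_mul_le_iff₀ (by positivity)] at h2
    calc Real.exp (-x ^ 2 / 2) ≤ _ := h2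
      _ ≤ 3 * (2 * a * (4 * K * N / 2 ^ N)) := by
        have hx0 : 0 ≤ -x := by linarith
        have := cdf_gaussianReal_pos x
        have ha0 : 0 ≤ a := hx0.trans hax.le
        gcongr
      _ = 24 * a * (K * N) / 2 ^ N := by ring
      _ ≤ K * (K * K) / 2 ^ N := by gcongr <;> linarith
      _ = _ := by ring
  have hx2 : a ^ 2 - 6 * Real.log K ≤ x ^ 2 := by
    have h1 := Real.log_le_log (Real.exp_pos _) hexp
    rw [Real.log_exp, Real.log_div (by positivity) (by positivity), Real.log_pow,
      Real.log_pow] at h1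
    push_cast at h1
    rw [ha2]
    linarith
  have hδa : a ^ 2 * δ = 8 * Real.log 2 * Real.log K := by
    rw [ha2, hδ]; field_simp; ring
  have hδ3 : δ ≤ 1 / 3 := by
    rw [hδ, div_le_iff₀ hN0]; linarith
  refine (abs_le_of_sq_le_sq' ?_ (mul_nonneg (invMills_pos x).le (by positivity))).2
  -- The gain 2 a² δ = 16 (log 2)(log K) exceeds the loss 6 (1 + 2δ) log K ≤ 10 log K, as δ ≤ 1/3.
  calc a ^ 2 ≤ (a ^ 2 - 6 * Real.log K) * (1 + 2 * δ) := by
        have h1 : Real.log K * δ ≤ Real.log K * (1 / 3) := mul_le_mul_of_nonneg_left hδ3 hL0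
        have h2 : 0.69 * Real.log K ≤ Real.log 2 * Real.log K :=
          mul_le_mul_of_nonneg_right (by linarith) hL0
        nlinarith
    _ ≤ x ^ 2 * (1 + 2 * δ) := mul_le_mul_of_nonneg_right hx2 (by positivity)
    _ ≤ (-x * (1 + δ)) ^ 2 := by nlinarith [sq_nonneg (x * δ)]
    _ ≤ _ := by
        have : 0 ≤ -x := by linarith
        gcongr

/-! ### Comparison of energies with log-ratios, and the bound on regular realizations. -/

section Deterministic

variable {N K : ℕ} {x : Config N → ℝ}

lemma logRatio_eq (x : Config N → ℝ) (i : Fin (2 ^ N)) :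
    logRatio x i = Real.log (cdf (gaussianReal 0 1) (x (sortedConfig x i))) -
      Real.log (cdf (gaussianReal 0 1) (lowest x)) := by
  have h1 := unifOrderStat_succ x i.2
  have h2 := unifOrderStat_succ x (i := 0) (by positivity)
  rw [logRatio, h1, h2]
  rfl

lemma lowest_le (x : Config N → ℝ) (i : Fin (2 ^ N)) : lowest x ≤ x (sortedConfig x i) :=
  monotone_comp_sortedConfig x (Fin.mk_le_of_le_val (Nat.zero_le _))

lemma logRatio_nonneg (x : Config N → ℝ) (i : Fin (2 ^ N)) : 0 ≤ logRatio x i := by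
  rw [logRatio_eq]
  exact (mul_nonneg (invMills_pos _).le (sub_nonneg.2 (lowest_le x i))).trans
    (log_cdf_gaussianReal_sub_mem (lowest_le x i)).1

/-- The slope of log Φ is largest at the ground state, so one bound there serves every level; then
(1 - δ)(1 + δ) ≤ 1. -/
lemma sub_mul_logRatio_le {a δ : ℝ} (hδ : 0 ≤ δ) (h : invMills (lowest x) ≤ a * (1 + δ))
    (i : Fin (2 ^ N)) : (1 - δ) * logRatio x i ≤ a * (x (sortedConfig x i) - lowest x) := by
  have h0 := logRatio_nonneg x i
  have h1 := (log_cdf_gaussianReal_sub_mem (lowest_le x i)).2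
  rw [← logRatio_eq] at h1
  have h2 := h1.trans (mul_le_mul_of_nonneg_right h (sub_nonneg.2 (lowest_le x i)))
  have h3 : (1 - δ) * logRatio x i * (1 + δ) ≤
      a * (x (sortedConfig x i) - lowest x) * (1 + δ) := by
    nlinarith [mul_nonneg (sq_nonneg δ) h0]
  exact le_of_mul_le_mul_right h3 (by positivity)

/-- Here the smallest slope matters, that at the upper end, so the bound stops at level `m`. -/
lemma le_add_mul_logRatio {a δ : ℝ} (hδ : 0 ≤ δ) {m : Fin (2 ^ N)}
    (h : a ≤ invMills (x (sortedConfig x m)) * (1 + δ)) {i : Fin (2 ^ N)} (hi : i ≤ m) :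
    a * (x (sortedConfig x i) - lowest x) ≤ (1 + δ) * logRatio x i := by
  have h1 := (log_cdf_gaussianReal_sub_mem (lowest_le x i)).1
  rw [← logRatio_eq] at h1
  have hs := sub_nonneg.2 (lowest_le x i)
  have h2 := antitone_invMills (monotone_comp_sortedConfig x hi)
  calc _ ≤ invMills (x (sortedConfig x m)) * (1 + δ) * (x (sortedConfig x i) - lowest x) := by
        gcongr
    _ ≤ invMills (x (sortedConfig x i)) * (1 + δ) * (x (sortedConfig x i) - lowest x) := by
        gcongr
    _ = (1 + δ) * (invMills (x (sortedConfig x i)) * (x (sortedConfig x i) - lowest x)) := by ring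
    _ ≤ _ := by gcongr

lemma Regular.exp_neg_logRatio_le (h : Regular K N x) {i : ℕ} (hi : N ≤ i + 1)
    (hi' : i < 2 ^ N) : Real.exp (-logRatio x i) ≤ 32 * Real.log (N + 1) / (i + 1) := by
  have hU := unifOrderStat_pos x (j := i + 1) (by omega)
  have hg := h.growth (i + 1) (by rw [Finset.mem_Icc]; omega) hi
  push_cast at hg
  rw [logRatio, neg_sub, Real.exp_sub, Real.exp_log hU, Real.exp_log (unifOrderStat_pos x le_rfl),
    div_le_div_iff₀ hU (by positivity)]
  have hlog : 0 ≤ Real.log ((N : ℝ) + 1) := Real.log_nonneg (by simp)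
  calc unifOrderStat x 1 * ((i : ℝ) + 1)
      ≤ 2 * Real.log (N + 1) / 2 ^ N * ((i : ℝ) + 1) := by gcongr; exact h.upper
    _ = 32 * Real.log (N + 1) * (((i : ℝ) + 1) / (16 * 2 ^ N)) := by field_simp; ring
    _ ≤ _ := by gcongr

end Deterministic

lemma two_mul_div_le_of_le {S Z E T : ℝ} (hE : 0 ≤ E) (hT : 0 ≤ T) (hZ : 1 ≤ Z)
    (hS : S ≤ 4 * E * Real.exp (4 * E) * Z + 4 * E + T) :
    2 * S / Z ≤ 16 * E * Real.exp (16 * E) + 3 * T := by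
  have hZ0 : 0 < Z := by linarith
  have h1 : 1 ≤ Real.exp (4 * E) := Real.one_le_exp (by positivity)
  have h2 : 4 * E ≤ 4 * E * (Real.exp (4 * E) * Z) :=
    le_mul_of_one_le_right (by positivity) (one_le_mul_of_one_le_of_one_le h1 hZ)
  have h3 : T ≤ T * Z := le_mul_of_one_le_right hT hZ
  have h4 : 4 * E * Real.exp (4 * E) * Z ≤ 4 * E * Real.exp (16 * E) * Z := by
    gcongr
    linarith
  rw [div_le_iff₀ hZ0]
  linarith

/-- The `K`-th level is far in the lower tail. -/
lemma Regular.exists_top {N K : ℕ} {x : Config N → ℝ} (h : Regular K N x) (hN : 1000 ≤ N)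
    (hNK : N + 1 ≤ K) (hKN : 12 * Real.log K ≤ N)
    (hcdf : Real.exp (-(N / 4)) ≤ cdf (gaussianReal 0 1) (-1)) :
    ∃ m : Fin (2 ^ N), (m : ℕ) + 1 = K ∧
      cdf (gaussianReal 0 1) (x (sortedConfig x m)) ≤ 4 * K * N / 2 ^ N ∧
      x (sortedConfig x m) ≤ -1 := by
  have hNR : (1000 : ℝ) ≤ N := by exact_mod_cast hN
  have hNKR : (N : ℝ) + 1 ≤ K := by exact_mod_cast hNK
  have hK0 : (0 : ℝ) < K := by linarith
  -- Together with 2^N ≥ exp(N/2), this makes 4KN/2^N at most exp(-N/4), hence at most Φ(-1).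
  have hK3 : (K : ℝ) ^ 3 ≤ Real.exp (N / 4) := by
    have h1 : (K : ℝ) ^ 3 = Real.exp (3 * Real.log K) := by
      rw [mul_comm, Real.exp_mul, Real.exp_log hK0]
      norm_cast
    rw [h1, Real.exp_le_exp]
    linarith
  have h2N : Real.exp (N / 2) ≤ (2 : ℝ) ^ N := by
    have h1 : (2 : ℝ) ^ N = Real.exp (Real.log 2 * N) := by
      rw [Real.exp_mul, Real.exp_log two_pos]; norm_cast
    rw [h1, Real.exp_le_exp]
    nlinarith [Real.log_two_gt_d9]
  have h2K : 2 * K ≤ 2 ^ N := by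
    have h1 : 2 * (K : ℝ) ≤ K ^ 3 := by nlinarith [mul_pos hK0 hK0]
    have h2 : Real.exp ((N : ℝ) / 4) ≤ Real.exp (N / 2) := Real.exp_le_exp.2 (by linarith)
    exact_mod_cast h1.trans (hK3.trans (h2.trans h2N))
  have htop := h.top (by omega) h2K
  obtain ⟨m, hm⟩ : ∃ m : Fin (2 ^ N), (m : ℕ) + 1 = K := ⟨⟨K - 1, by omega⟩, by simp; omega⟩
  have htop' : cdf (gaussianReal 0 1) (x (sortedConfig x m)) ≤ 4 * K * N / 2 ^ N := by
    rwa [← hm, unifOrderStat_succ x m.2, hm] at htop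
  refine ⟨m, hm, htop', ?_⟩
  · rw [← strictMono_cdf_gaussianReal.le_iff_le]
    refine htop'.trans (le_trans ?_ hcdf)
    rw [div_le_iff₀ (by positivity)]
    calc 4 * (K : ℝ) * N ≤ K ^ 3 := by nlinarith [mul_pos hK0 hK0]
      _ ≤ Real.exp (N / 4) := hK3
      _ = Real.exp (-(N / 4)) * Real.exp (N / 2) := by rw [← Real.exp_add]; ring_nf
      _ ≤ _ := by gcongr

lemma Regular.dTV_le {N K : ℕ} {x : Config N → ℝ} (h : Regular K N x) {β η : ℝ} (hη : 0 < η)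
    (hb : β / betaC = 1 + 4 * η) (hN : 1000 ≤ N) (hNK : N + 1 ≤ K)
    (hKN : 12 * Real.log K ≤ N) (hδ : β / betaC * (4 * Real.log K / N) ≤ η)
    (hcdf : Real.exp (-(N / 4)) ≤ cdf (gaussianReal 0 1) (-1))
    (hsmall : (N : ℝ) ^ (-(2 * η)) +
      (32 * Real.log (N + 1)) ^ (1 + 2 * η) * ((N : ℝ) ^ (-(2 * η)) / (2 * η)) ≤ η)
    (htail : (32 * Real.log (N + 1)) ^ (1 + 3 * η) * (N : ℝ) ^ (-η) ≤ 1) :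
    dTV (gibbs β x) (approxGibbs K β x (expSpacing x)) ≤
      16 * (β / betaC) * eps K N * Real.exp (16 * (β / betaC) * eps K N)
        + 4 / (β / betaC - 1) * (1 / ((K : ℝ) - 1) ^ ((β / betaC - 1) / 2)) := by
  have hNR : (1000 : ℝ) ≤ N := by exact_mod_cast hN
  have hNKR : (N : ℝ) + 1 ≤ K := by exact_mod_cast hNK
  have hN0 : (0 : ℝ) < N := by linarith
  have hK0 : (0 : ℝ) < K := by linarith
  have hL0 : 0 ≤ Real.log K := Real.log_nonneg (by linarith)
  obtain ⟨m, hm, htop', hxm⟩ := h.exists_top hN hNK hKN hcdf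
  have hx0 : lowest x ≤ -1 := (lowest_le x m).trans hxm
  have hlow : 1 / (2 ^ N * ((N : ℝ) + 1) ^ 2) < cdf (gaussianReal 0 1) (lowest x) := by
    have := h.lower
    rwa [unifOrderStat_succ x (i := 0) (by positivity)] at this
  have hA := invMills_le_of_lower (by omega) hNK (by omega) hx0 hlow
  have hB := le_invMills_of_top hN hNK hKN hxm htop'
  set a := betaC * Real.sqrt N with ha
  set δ := 4 * Real.log K / N with hδd
  set b := β / betaC with hbd
  have hb0 : 0 < b := by linarith
  have hδ0 : 0 ≤ δ := by positivity
  set l := 32 * Real.log ((N : ℝ) + 1) with hl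
  have hl0 : 0 < l := mul_pos (by norm_num) (Real.log_pos (by linarith))
  have hΛ : 1 ≤ Real.log N := by
    rw [Real.le_log_iff_exp_le hN0]; linarith [Real.exp_one_lt_d9]
  have hgr (i : ℕ) (hi : N ≤ i + 1) (hi' : i < 2 ^ N) := h.exp_neg_logRatio_le hi hi'
  have hmain := sum_abs_exp_sub_exp_le (K := K)
    (D := fun i => a * (x (sortedConfig x i) - lowest x)) (g := logRatio x) hη hb hδ0 hδ
    (by linarith : 0 ≤ Real.log N) (logRatio_nonneg x) (sub_mul_logRatio_le hδ0 hA)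
    fun i hi => le_add_mul_logRatio hδ0 hB (Fin.le_def.2 (by omega))
  have hR := sum_exp_neg_large_le (s := 2 * η) (M := N) (n := 2 ^ N) (g := logRatio x)
    (by positivity) hl0 (by omega) fun i hi hi' => hgr i (by omega) hi'
  have hT := sum_exp_neg_tail_le (s := 3 * η) (M := K) (n := 2 ^ N) (g := logRatio x)
    (by positivity) hl0 (by omega) fun i hi hi' => hgr i (by omega) hi'
  obtain ⟨hZ, hd⟩ := dTV_gibbs_approxGibbs_le (K := K) (by omega) β x
  have hβ : β = b * betaC := by rw [hbd, div_mul_cancel₀ _ betaC_pos.ne']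
  have hw (i : Fin (2 ^ N)) : -β * (Real.sqrt N * (x (sortedConfig x i) - lowest x)) =
      -b * (a * (x (sortedConfig x i) - lowest x)) := by rw [hβ, ha]; ring
  simp only [hw] at hd
  rw [← hbd] at hZ hd
  set Z := ∑ i : Fin (2 ^ N), (if (i : ℕ) < K then Real.exp (-b * logRatio x i) else 0) with hZd
  set S := ∑ i : Fin (2 ^ N), |Real.exp (-b * (a * (x (sortedConfig x i) - lowest x))) -
    if (i : ℕ) < K then Real.exp (-b * logRatio x i) else 0| with hSd
  have heps : b * δ * Real.log N = 4 * b * eps K N := by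
    rw [hδd, eps]; ring
  have he0 : 0 ≤ eps K N := by
    rw [eps]; exact div_nonneg (mul_nonneg hL0 (by linarith)) hN0.le
  set E := b * eps K N with hE
  have hE0 : 0 ≤ E := mul_nonneg hb0.le he0
  have hbδE : b * δ ≤ 4 * E := by
    have := le_mul_of_one_le_right (mul_nonneg hb0.le hδ0) hΛ
    linarith
  -- The factor K^{-η} ≤ N^{-η} absorbs the power of log(N+1); the rest, K^{-2η}, has the exponent
  -- 2η = (b - 1)/2 of the claim.
  have hT' : l ^ (1 + 3 * η) * ((K : ℝ) ^ (-(3 * η)) / (3 * η)) ≤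
      1 / (3 * η) * (1 / ((K : ℝ) - 1) ^ (2 * η)) := by
    have h1 : (K : ℝ) ^ (-(3 * η)) = (K : ℝ) ^ (-η) * (K : ℝ) ^ (-(2 * η)) := by
      rw [← Real.rpow_add hK0]; ring_nf
    have h2 : (K : ℝ) ^ (-η) ≤ (N : ℝ) ^ (-η) :=
      Real.rpow_le_rpow_of_nonpos hN0 (by linarith) (by linarith)
    have h3 : (K : ℝ) ^ (-(2 * η)) ≤ 1 / ((K : ℝ) - 1) ^ (2 * η) := by
      rw [one_div, ← Real.rpow_neg (by linarith)]
      exact Real.rpow_le_rpow_of_nonpos (by linarith) (by linarith) (by linarith)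
    calc _ = 1 / (3 * η) * (l ^ (1 + 3 * η) * (K : ℝ) ^ (-η) * (K : ℝ) ^ (-(2 * η))) := by
          rw [h1]; ring
      _ ≤ 1 / (3 * η) * (1 * (K : ℝ) ^ (-(2 * η))) := by
          gcongr
          exact (mul_le_mul_of_nonneg_left h2 (by positivity)).trans htail
      _ ≤ _ := by rw [one_mul]; gcongr
  have hR' : b * δ / η * ∑ i : Fin (2 ^ N),
      (if Real.log N < logRatio x i then Real.exp (-(1 + 2 * η) * logRatio x i) else 0) ≤
      4 * E := by
    calc _ ≤ b * δ / η * η := by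
          have := hR.trans hsmall
          gcongr
      _ = b * δ := by field_simp
      _ ≤ _ := hbδE
  have hS : S ≤ 4 * E * Real.exp (4 * E) * Z + 4 * E +
      1 / (3 * η) * (1 / ((K : ℝ) - 1) ^ (2 * η)) := by
    have h4 : b * δ * Real.log N = 4 * E := by rw [heps, hE]; ring
    rw [h4] at hmain
    exact hmain.trans (add_le_add (add_le_add le_rfl hR') (hT.trans hT'))
  have hT0 : 0 ≤ 1 / (3 * η) * (1 / ((K : ℝ) - 1) ^ (2 * η)) := by
    have : 0 ≤ (K : ℝ) - 1 := by linarith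
    positivity
  have hfin := two_mul_div_le_of_le hE0 hT0 hZ hS
  refine hd.trans (hfin.trans (le_of_eq ?_))
  -- Three times the prefactor 1/(3η) is 1/η = 4/(b - 1), the constant of the claim.
  have hη1 : b - 1 = 4 * η := by linarith
  rw [hη1, show 4 * η / 2 = 2 * η by ring, show 16 * b * eps K N = 16 * E by rw [hE]; ring]
  field_simp

/-! ### Powers of the logarithm against powers of N. -/

section Asymptotics

lemma tendsto_log_rpow_mul_rpow_neg {p q : ℝ} (hq : 0 < q) :
    Tendsto (fun N : ℕ => (32 * Real.log ((N : ℝ) + 1)) ^ p * (N : ℝ) ^ (-q)) atTop (𝓝 0) := by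
  have h1 : Tendsto (fun y : ℝ => Real.log y ^ p / y ^ q) atTop (𝓝 0) :=
    (isLittleO_log_rpow_rpow_atTop p hq).tendsto_div_nhds_zero
  have hN1 : Tendsto (fun N : ℕ => (N : ℝ) + 1) atTop atTop :=
    tendsto_atTop_add_const_right _ _ tendsto_natCast_atTop_atTop
  have h2 := ((h1.comp hN1).const_mul (32 ^ p * 2 ^ q))
  rw [mul_zero] at h2
  refine squeeze_zero' (Eventually.of_forall fun N => ?_) ?_ h2
  · have : 0 ≤ Real.log ((N : ℝ) + 1) := Real.log_nonneg (by simp)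
    positivity
  · filter_upwards [eventually_ge_atTop 1] with N hN
    have hNR : (1 : ℝ) ≤ N := by exact_mod_cast hN
    have hlog : 0 ≤ Real.log ((N : ℝ) + 1) := Real.log_nonneg (by linarith)
    -- From N + 1 ≤ 2N.
    have h3 : (N : ℝ) ^ (-q) ≤ 2 ^ q / ((N : ℝ) + 1) ^ q := by
      rw [Real.rpow_neg (by linarith), ← Real.div_rpow (by norm_num) (by linarith),
        ← Real.inv_rpow (by linarith)]
      refine Real.rpow_le_rpow (by positivity) ?_ hq.le
      rw [inv_eq_one_div, div_le_div_iff₀ (by linarith) (by linarith)]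
      linarith
    rw [Real.mul_rpow (by norm_num) hlog]
    calc _ ≤ 32 ^ p * Real.log ((N : ℝ) + 1) ^ p * (2 ^ q / ((N : ℝ) + 1) ^ q) := by gcongr
      _ = _ := by simp only [Function.comp]; ring

lemma tendsto_natCast_rpow_neg {q : ℝ} (hq : 0 < q) :
    Tendsto (fun N : ℕ => (N : ℝ) ^ (-q)) atTop (𝓝 0) :=
  (tendsto_rpow_neg_atTop hq).comp tendsto_natCast_atTop_atTop

end Asymptotics

end REM

theorem proposition3p1 :
    ∃ C : ℝ, 0 < C ∧
      ∀ (Ω : Type*) [MeasurableSpace Ω] (P : Measure Ω) [IsProbabilityMeasure P]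
        (X : (N : ℕ) → REM.Config N → Ω → ℝ),
        (∀ N σ, Measurable (X N σ)) →
        (∀ N σ, P.map (X N σ) = gaussianReal 0 1) →
        (∀ N, iIndepFun (X N) P) →
        -- for each `N`, the variables `W_1, ..., W_{2 ^ N}` are i.i.d. exponential of mean one
        (∀ N : ℕ,
          iIndepFun (fun (ℓ : Finset.Icc 1 (2 ^ N)) (ω : Ω) =>
            REM.expSpacing (fun σ => X N σ ω) (ℓ : ℕ)) P ∧
          ∀ ℓ ∈ Finset.Icc 1 (2 ^ N),
            HasLaw (fun ω => REM.expSpacing (fun σ => X N σ ω) ℓ) (expMeasure 1) P) ∧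
        ∀ (β : ℝ) (k : ℕ → ℕ), 1 < β / REM.betaC →
          Tendsto k atTop atTop →
          Tendsto (fun N : ℕ => (k N : ℝ) / (N : ℝ)) atTop atTop →
          Tendsto (fun N : ℕ => REM.eps (k N) N) atTop (𝓝 0) →
          ∀ᵐ ω ∂P, ∀ᶠ N : ℕ in atTop,
            REM.dTV (REM.gibbs β (fun σ => X N σ ω))
                (REM.approxGibbs (k N) β (fun σ => X N σ ω)
                  (REM.expSpacing (fun σ => X N σ ω)))
              ≤ C * (β / REM.betaC) * REM.eps (k N) N *
                    Real.exp (C * (β / REM.betaC) * REM.eps (k N) N)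
                + 4 / (β / REM.betaC - 1) *
                    (1 / ((k N : ℝ) - 1) ^ ((β / REM.betaC - 1) / 2)) := by
  refine ⟨16, by norm_num, fun Ω _ P _ X hX hlaw hind => ⟨fun N =>
    ⟨REM.iIndepFun_expSpacing (hX N) (hlaw N) (hind N),
      fun ℓ hℓ => REM.hasLaw_expSpacing (hX N) (hlaw N) (hind N) hℓ⟩, ?_⟩⟩
  intro β k hβ _ hkN heps
  obtain ⟨η, hη, hb⟩ : ∃ η : ℝ, 0 < η ∧ β / REM.betaC = 1 + 4 * η :=
    ⟨(β / REM.betaC - 1) / 4, by linarith, by ring⟩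
  have hb0 : 0 < β / REM.betaC := by linarith
  have hsmall : ∀ᶠ N : ℕ in atTop, (N : ℝ) ^ (-(2 * η)) +
      (32 * Real.log (N + 1)) ^ (1 + 2 * η) * ((N : ℝ) ^ (-(2 * η)) / (2 * η)) ≤ η := by
    have h1 := (REM.tendsto_natCast_rpow_neg (q := 2 * η) (by positivity)).add
      ((REM.tendsto_log_rpow_mul_rpow_neg (p := 1 + 2 * η) (q := 2 * η)
        (by positivity)).div_const (2 * η))
    rw [zero_div, add_zero] at h1
    filter_upwards [h1.eventually_le_const hη] with N hN
    rwa [← mul_div_assoc]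
  have htail : ∀ᶠ N : ℕ in atTop,
      (32 * Real.log ((N : ℝ) + 1)) ^ (1 + 3 * η) * (N : ℝ) ^ (-η) ≤ 1 :=
    (REM.tendsto_log_rpow_mul_rpow_neg hη).eventually_le_const one_pos
  have hcdf : ∀ᶠ N : ℕ in atTop,
      Real.exp (-((N : ℝ) / 4)) ≤ cdf (gaussianReal 0 1) (-1) := by
    have h1 : Tendsto (fun N : ℕ => Real.exp (-((N : ℝ) / 4))) atTop (𝓝 0) :=
      Real.tendsto_exp_neg_atTop_nhds_zero.comp
        (tendsto_natCast_atTop_atTop.atTop_div_const (by norm_num))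
    exact h1.eventually_le_const (REM.cdf_gaussianReal_pos _)
  -- Since (log k_N)/N ≤ ε_N once log N ≥ 1, the first entry yields 12 log k_N ≤ N and the second bδ
  -- ≤ η.
  have hc : 0 < min (1 / 12) (η / (4 * (β / REM.betaC))) := by positivity
  filter_upwards [REM.ae_eventually_regular hX hlaw hind k] with ω hω
  filter_upwards [hω, hsmall, htail, hcdf, heps.eventually_le_const hc,
    hkN.eventually_ge_atTop 2, eventually_ge_atTop 1000] with N hreg h1 h2 h3 h4 h5 hN
  have hNR : (1000 : ℝ) ≤ N := by exact_mod_cast hN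
  have hN0 : (0 : ℝ) < N := by linarith
  have hNk : N + 1 ≤ k N := by
    rw [le_div_iff₀ hN0] at h5
    have : 2 * N ≤ k N := by exact_mod_cast h5
    omega
  have hΛ : 1 ≤ Real.log N := by
    rw [Real.le_log_iff_exp_le hN0]; linarith [Real.exp_one_lt_d9]
  have hlogk : Real.log (k N) / N ≤ REM.eps (k N) N := by
    rw [REM.eps]
    gcongr
    refine le_mul_of_one_le_right (Real.log_nonneg ?_) hΛ
    exact_mod_cast (by omega : 1 ≤ k N)
  have h6 := hlogk.trans h4
  have h7 := h6.trans (min_le_left _ _)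
  have h8 := h6.trans (min_le_right _ _)
  refine hreg.dTV_le hη hb hN hNk ?_ ?_ h3 h1 h2
  · rw [div_le_iff₀ hN0] at h7
    linarith
  · rw [le_div_iff₀ (by positivity)] at h8
    calc _ = Real.log (k N) / N * (4 * (β / REM.betaC)) := by ring
      _ ≤ η := h8
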